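/- Let $f(x)\in x+x^2\mathbb{C}[[x]]$ be a formal power series, let $\omega(x)\in x+x^2\mathbb{C}[[x]]$ be the functional (compositional) inverse of $f(x)/f'(x)$, and for $s\in\mathbb{C}$ let $$p_s(\alpha)=\alpha\left(\frac{D}{f(D)}\right)^s\alpha^{s-1}=\sum_{k\ge 0}(s-1)(s-2)\cdots(s-k)\,\Big([x^k]\Big(\frac{x}{f(x)}\Big)^s\Big)\,\alpha^{s-k}\;\in\;\alpha^s\big(1+\alpha^{-1}\mathbb{C}[[\alpha^{-1}]]\big),\qquad D=\frac{\partial}{\partial\alpha},$$ a formal series in $\alpha$. Write $p_s'=\partial p_s/\partial\alpha$ and $\dot p_s=\partial p_s/\partial s$ (the latter involving $\ln\alpha$). The substitution $\alpha\mapsto s\alpha$ acts by $\alpha^c\mapsto s^c\alpha^c$ and $\ln\alpha\mapsto\ln\alpha+\ln s$ (principal branches); if $u\in 1+x\mathbb{C}[[x]]$, then $u^c$ and $\ln u$ are the formal power and logarithm, and $\ln\big(\alpha^s u(\alpha^{-1})\big)=s\ln\alpha+\ln u(\alpha^{-1})$. Limits of formal series in powers of $\alpha$ and $\ln\alpha$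 are taken coefficientwise, and $s\to\infty$ means $|s|\to\infty$ in $\mathbb{C}$. Then for every $H\in\mathbb{C}$ the following hold. First limit formula: $$\lim_{s\to\infty}\left(\frac{\dot p_s(s\alpha)}{p_s(s\alpha)}-\ln s\right)=\ln\alpha-\ln f'(\omega(\alpha^{-1})),\qquad \lim_{s\to\infty}\frac{p_{s+H}(s\alpha)}{p_s(s\alpha)}\,s^{-H}=\alpha^H f'(\omega(\alpha^{-1}))^{-H}.$$ Second limit formula: $$\lim_{s\to\infty}\left(\ln p_s(\alpha s)-s\ln(\alpha s)+s\alpha\int_0^{\alpha^{-1}}\ln f'(\omega(t))\,dt\right)=\frac12\ln\omega'(\alpha^{-1}),$$ $$\lim_{s\to\infty}\left(\frac{p_{s+H}(s\alpha)}{p_s(s\alpha)}\,s^{1-H}-s\,\alpha^H f'(\omega(\alpha^{-1}))^{-H}\right)=\frac H2\,\alpha^H f'(\omega(\alpha^{-1}))^{-H}\left(H\big(1-\omega'(\alpha^{-1})\big)+\alpha^{-1}\frac{\omega''(\alpha^{-1})}{\omega'(\alpha^{-1})}\right).$$ Moreover $$\lim_{s\to\infty}\frac{p_s'(s\alpha)}{p_s(s\alpha)}=\omega(\alpha^{-1}),$$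 in particular $\lim_{n\to\infty}p_n'(n\alpha)/p_n(n\alpha)=\omega(\alpha^{-1})$ along the natural numbers $n$. -/

import Mathlib

open Filter Topology Polynomial
open scoped PowerSeries ComplexOrder

noncomputable section

namespace BinomialType

/-! ### Formal power series -/

/-- `f ∈ x + x² ℂ⟦x⟧`. -/
structure IsNormalized (f : ℂ⟦X⟧) : Prop where
  constantCoeff_eq : PowerSeries.constantCoeff f = 0
  coeff_one_eq : PowerSeries.coeff 1 f = 1

/-- The complex power `u ^ s = ∑ k, binom(s, k) (u - 1) ^ k` of a series `u ∈ 1 + x ℂ⟦x⟧`. -/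
def onePow (u : ℂ⟦X⟧) (s : ℂ) : ℂ⟦X⟧ :=
  (PowerSeries.binomialSeries ℂ s).subst (u - 1)

/-- The formal antiderivative `∫₀ˣ g(t) dt`. -/
def integral (g : ℂ⟦X⟧) : ℂ⟦X⟧ :=
  PowerSeries.mk fun n => if n = 0 then 0 else PowerSeries.coeff (n - 1) g / n

/-- The series `f(x) / x`, for `f` without constant term. -/
def divX (f : ℂ⟦X⟧) : ℂ⟦X⟧ :=
  PowerSeries.mk fun n => PowerSeries.coeff (n + 1) f

/-- The series `𝔗f = f / f'`. -/
def logDerivInv (f : ℂ⟦X⟧) : ℂ⟦X⟧ :=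
  f * (PowerSeries.derivative ℂ f)⁻¹

theorem constantCoeff_derivative {f : ℂ⟦X⟧} (hf : IsNormalized f) :
    PowerSeries.constantCoeff (PowerSeries.derivative ℂ f) = 1 := by
  rw [← PowerSeries.coeff_zero_eq_constantCoeff_apply]
  simp [PowerSeries.coeff_derivative, hf.coeff_one_eq]

theorem constantCoeff_logDerivInv {f : ℂ⟦X⟧} (hf : IsNormalized f) :
    PowerSeries.constantCoeff (logDerivInv f) = 0 := by
  simp [logDerivInv, hf.constantCoeff_eq]

theorem coeff_one_logDerivInv {f : ℂ⟦X⟧} (hf : IsNormalized f) :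
    PowerSeries.coeff 1 (logDerivInv f) = 1 := by
  rw [logDerivInv, PowerSeries.coeff_mul, Finset.Nat.antidiagonal_succ]
  simp [hf.constantCoeff_eq, hf.coeff_one_eq, PowerSeries.constantCoeff_inv,
    constantCoeff_derivative hf]

/-- `ω = (𝔗f)^inv`, the functional inverse of `f / f'`. -/
def omega (f : ℂ⟦X⟧) (hf : IsNormalized f) : ℂ⟦X⟧ :=
  (logDerivInv f).substInvOfIsUnit (by rw [coeff_one_logDerivInv hf]; exact isUnit_one)

theorem logDerivInv_subst_omega {f : ℂ⟦X⟧} (hf : IsNormalized f) :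
    (logDerivInv f).subst (omega f hf) = PowerSeries.X :=
  PowerSeries.subst_substInvOfIsUnit_right _ (constantCoeff_logDerivInv hf) _

/-- The series `f'(ω(x))`. -/
def derivOmega (f : ℂ⟦X⟧) (hf : IsNormalized f) : ℂ⟦X⟧ :=
  (PowerSeries.derivative ℂ f).subst (omega f hf)

/-! ### Formal series in complex powers of `α` and in `ln α` -/

/-- Formal series in `α` whose terms are `α ^ c` (`c` complex) times a polynomial in `ln α`:
Hahn series in `x = α⁻¹`, with exponents in `ℂ` (where `a ≤ b` means that `b - a` is a nonnegative
real number) and with coefficients in `ℂ[ln α]`. The coefficient at `γ` is that of `α ^ (-γ)`. -/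
abbrev AsympSeries : Type := HahnSeries ℂ ℂ[X]

/-- A complex number as a constant series. -/
def const (z : ℂ) : AsympSeries := HahnSeries.C (Polynomial.C z)

/-- The monomial `α ^ c`. -/
def alphaPow (c : ℂ) : AsympSeries := HahnSeries.single (-c) 1

/-- The series `ln α`. -/
def lnAlpha : AsympSeries := HahnSeries.C Polynomial.X

/-- The series `u(α⁻¹)`. -/
def ofSeries (u : ℂ⟦X⟧) : AsympSeries :=
  HahnSeries.ofPowerSeries ℂ ℂ[X] (PowerSeries.map Polynomial.C u)

/-- The substitution `α ↦ s α`: it takes `α ^ c` to `s ^ c α ^ c` and `ln α` to `ln α + ln s`. -/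
def scale (s : ℂ) (F : AsympSeries) : AsympSeries where
  coeff γ := Polynomial.C (s ^ (-γ)) * (F.coeff γ).comp (Polynomial.X + Polynomial.C (Complex.log s))
  isPWO_support' := F.isPWO_support.mono fun γ hγ h0 => hγ (by simp [h0])

/-- The operator `∂/∂α`: it takes `α ^ c (ln α) ^ j` to
`α ^ (c - 1) (c (ln α) ^ j + j (ln α) ^ (j - 1))`. -/
def alphaDeriv (F : AsympSeries) : AsympSeries :=
  alphaPow (-1) *
    { coeff := fun γ => Polynomial.C (-γ) * F.coeff γ + Polynomial.derivative (F.coeff γ)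
      isPWO_support' := F.isPWO_support.mono fun γ hγ h0 => hγ (by simp [h0]) }

/-- The limit of formal series: convergence of each coefficient. -/
def CoeffTendsto (F : ℂ → AsympSeries) (l : Filter ℂ) (G : AsympSeries) : Prop :=
  ∀ (γ : ℂ) (j : ℕ), Tendsto (fun s => ((F s).coeff γ).coeff j) l (𝓝 ((G.coeff γ).coeff j))

/-! ### The continuation `p_s(α)` of the polynomials of binomial type -/

/-- The series `u_s` with `p_s(α) = α ^ s u_s(α⁻¹)`. As
`D ^ k α ^ (s - 1) = (s - 1) (s - 2) ⋯ (s - k) α ^ (s - 1 - k)`, its coefficient of index `k` in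
`p_s(α) = α (D / f(D)) ^ s α ^ (s - 1)` is `[x ^ k] (x / f(x)) ^ s` times a falling factorial. -/
def pSeries (f : ℂ⟦X⟧) (s : ℂ) : ℂ⟦X⟧ :=
  PowerSeries.mk fun k =>
    PowerSeries.coeff k (onePow (divX f)⁻¹ s) * (descPochhammer ℂ k).eval (s - 1)

/-- `p_s(α) = α (D / f(D)) ^ s α ^ (s - 1)`, where `D = ∂/∂α`. -/
def p (f : ℂ⟦X⟧) (s : ℂ) : AsympSeries :=
  alphaPow s * ofSeries (pSeries f s)

/-- `∂/∂s p_s(α) = α ^ s (ln α u_s(α⁻¹) + (∂u_s/∂s)(α⁻¹))`. -/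
def pDot (f : ℂ⟦X⟧) (s : ℂ) : AsympSeries :=
  alphaPow s * (lnAlpha * ofSeries (pSeries f s) +
    ofSeries (PowerSeries.mk fun k => deriv (fun z => PowerSeries.coeff k (pSeries f z)) s))

/-- `ln p_s(α) = s ln α + ln u_s(α⁻¹)`. -/
def lnP (f : ℂ⟦X⟧) (s : ℂ) : AsympSeries :=
  const s * lnAlpha + ofSeries (pSeries f s).logOf

theorem constantCoeff_divX_inv {f : ℂ⟦X⟧} (hf : IsNormalized f) :
    PowerSeries.constantCoeff (divX f)⁻¹ = 1 := by
  rw [PowerSeries.constantCoeff_inv, ← PowerSeries.coeff_zero_eq_constantCoeff_apply]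
  simp [divX, hf.coeff_one_eq]

theorem hasSubst_sub_one {u : ℂ⟦X⟧} (hu : PowerSeries.constantCoeff u = 1) :
    PowerSeries.HasSubst (u - 1) :=
  PowerSeries.HasSubst.of_constantCoeff_zero' (by simp [hu])

theorem constantCoeff_onePow {u : ℂ⟦X⟧} (hu : PowerSeries.constantCoeff u = 1) (s : ℂ) :
    PowerSeries.constantCoeff (onePow u s) = 1 := by
  rw [← PowerSeries.coeff_zero_eq_constantCoeff_apply, onePow,
    PowerSeries.coeff_subst' (hasSubst_sub_one hu), finsum_eq_single _ 0]
  · simp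
  · intro d hd
    simp [hu, hd]

theorem constantCoeff_pSeries {f : ℂ⟦X⟧} (hf : IsNormalized f) (s : ℂ) :
    PowerSeries.constantCoeff (pSeries f s) = 1 := by
  rw [← PowerSeries.coeff_zero_eq_constantCoeff_apply]
  simp [pSeries, constantCoeff_onePow (constantCoeff_divX_inv hf)]

theorem isUnit_alphaPow (c : ℂ) : IsUnit (alphaPow c) :=
  IsUnit.of_mul_eq_one (alphaPow (-c)) (by simp [alphaPow])

theorem isUnit_ofSeries {u : ℂ⟦X⟧} (hu : PowerSeries.constantCoeff u ≠ 0) :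
    IsUnit (ofSeries u) :=
  IsUnit.of_mul_eq_one (ofSeries u⁻¹) (by
    simp only [ofSeries, ← map_mul, PowerSeries.mul_inv_cancel u hu, map_one])

/-- The series `p_s(α)` is invertible, so that one may divide by it. -/
theorem isUnit_p {f : ℂ⟦X⟧} (hf : IsNormalized f) (s : ℂ) : IsUnit (p f s) :=
  (isUnit_alphaPow s).mul (isUnit_ofSeries (by simp [constantCoeff_pSeries hf]))

theorem scale_alphaPow_mul_ofSeries {t : ℂ} (ht : t ≠ 0) (c : ℂ) (u : ℂ⟦X⟧) :
    scale t (alphaPow c * ofSeries u) =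
      const (t ^ c) * (alphaPow c * ofSeries (PowerSeries.rescale t⁻¹ u)) := by
  ext1
  funext γ
  simp only [scale, alphaPow, const, HahnSeries.C_apply, HahnSeries.coeff_single_mul, one_mul,
    sub_zero, ofSeries]
  by_cases h : ∃ n : ℕ, (n : ℂ) = γ - -c
  · obtain ⟨n, hn⟩ := h
    have h1 : -γ = c - n := by rw [hn]; ring
    rw [← hn, HahnSeries.ofPowerSeries_apply_coeff, HahnSeries.ofPowerSeries_apply_coeff, h1,
      Complex.cpow_sub _ _ ht, Complex.cpow_natCast]
    simp [div_eq_mul_inv, mul_assoc]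
  · have h0 : ∀ v : ℂ[X]⟦X⟧, (HahnSeries.ofPowerSeries ℂ ℂ[X] v).coeff (γ - -c) = 0 := by
      intro v
      rw [HahnSeries.ofPowerSeries_apply]
      refine HahnSeries.embDomain_notin_image_support ?_
      rintro ⟨n, -, hn⟩
      exact h ⟨n, hn⟩
    rw [h0, h0]
    simp

/-- The series `p_s(t α)` is invertible, so that one may divide by it. -/
theorem isUnit_scale_p {f : ℂ⟦X⟧} (hf : IsNormalized f) (s : ℂ) {t : ℂ} (ht : t ≠ 0) :
    IsUnit (scale t (p f s)) := by
  rw [p, scale_alphaPow_mul_ofSeries ht]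
  refine IsUnit.mul ?_ ((isUnit_alphaPow s).mul (isUnit_ofSeries ?_))
  · have h : t ^ s ≠ 0 := by simp [Complex.cpow_eq_zero_iff, ht]
    refine IsUnit.of_mul_eq_one (const (t ^ s)⁻¹) ?_
    simp only [const, ← map_mul, mul_inv_cancel₀ h, map_one]
  · rw [← PowerSeries.coeff_zero_eq_constantCoeff_apply, PowerSeries.coeff_rescale]
    simp [constantCoeff_pSeries hf]

theorem differentiable_choose (d : ℕ) : Differentiable ℂ fun s : ℂ => Ring.choose s d := by
  simp only [Ring.choose_eq_smul, Polynomial.descPochhammer_smeval_eq_ascPochhammer,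
    Polynomial.ascPochhammer_smeval_eq_eval]
  fun_prop

/-- The coefficients of `u_s` depend differentiably on `s`. -/
theorem differentiable_coeff_pSeries {f : ℂ⟦X⟧} (hf : IsNormalized f) (k : ℕ) :
    Differentiable ℂ fun s => PowerSeries.coeff k (pSeries f s) := by
  have hs := hasSubst_sub_one (constantCoeff_divX_inv hf)
  have hfin := PowerSeries.coeff_subst_finite' hs (PowerSeries.mk fun _ => (1 : ℂ)) k
  have h : ∀ s : ℂ, PowerSeries.coeff k (onePow (divX f)⁻¹ s) =
      ∑ d ∈ hfin.toFinset,
        Ring.choose s d * PowerSeries.coeff k (((divX f)⁻¹ - 1) ^ d) := by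
    intro s
    rw [onePow, PowerSeries.coeff_subst' hs, finsum_eq_sum_of_support_subset (s := hfin.toFinset)]
    · simp
    · intro d hd
      simp only [Set.Finite.coe_toFinset, Function.mem_support, PowerSeries.coeff_mk, one_smul]
      intro h0
      exact hd (by simp [h0])
  simp only [pSeries, PowerSeries.coeff_mk, h]
  have := differentiable_choose
  fun_prop

end BinomialType

end

noncomputable section

namespace BinomialType

local notation "𝐃" => PowerSeries.derivative ℂ
local notation "𝐗" => (PowerSeries.X : PowerSeries ℂ)
local notation "𝐂" => (PowerSeries.C : ℂ →+* PowerSeries ℂ)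
local notation "cf" => PowerSeries.coeff (R := ℂ)
local notation "cc" => PowerSeries.constantCoeff (R := ℂ)

/-! ### Formal differential calculus -/

/-! All five limits come from one formal saddle-point expansion. Put x = α⁻¹ and p_s(sα) = (sα)^s
v_s(x). Then v_s = T_s((x/f)^s), where T_s multiplies x^k by (1 - 1/s)⋯(1 - k/s). The claim is ln
v_s = s A + ½ ln ω' + O(1/s) coefficientwise, with x A' = 1 - ω/x, and with the remainder in each
degree a polynomial in 1/s (`exists_logOf_scaledP`).

To prove it, set W_j = e^(-sA) T_s((x/f)^s x^j). The operator T_s turns multiplication by x into x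
minus a first-order differential operator over s, and the phase e^(-sA) replaces that x by ω:
W_{j+1} = ω W_j - s⁻¹ x (x W_j)' (`moment_X_mul`). Moreover, with φ = x (ln(x/f))', x W_0' is s
times the failure of "x acts as ω" on φ (`X_mul_derivative_moment_one`). In terms of the deviations
s (W_j - ω^j W_0) only nonnegative powers of 1/s remain. Induction on the degree shows that the
coefficients of W_0 are polynomials in 1/s, and letting s → ∞ gives a linear differential equation
for K = lim W_0. Together with the twice differentiated saddle equation x (1 - φ(ω)) = ω it becomes
2 ω' K' = ω'' K, so ln K = ½ ln ω'.

The limits follow because (x A)' = -ln f'(ω). Polynomiality in 1/s permits differentiating in s and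
expanding at s + H; ratios are recovered from their logarithms by continuity of solutions of linear
equations (`coeffLim_of_derivative_eq`). -/

theorem derivative_mul (a b : ℂ⟦X⟧) : 𝐃 (a * b) = 𝐃 a * b + a * 𝐃 b := by
  rw [Derivation.leibniz, smul_eq_mul, smul_eq_mul]; ring

theorem coeff_C_mul' (a : ℂ) (u : ℂ⟦X⟧) (n : ℕ) : cf n (𝐂 a * u) = a * cf n u :=
  PowerSeries.coeff_C_mul ..

theorem coeff_X_mul_derivative (u : ℂ⟦X⟧) (n : ℕ) : cf n (𝐗 * 𝐃 u) = n * cf n u := by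
  cases n with
  | zero => simp
  | succ n => rw [PowerSeries.coeff_succ_X_mul, PowerSeries.coeff_derivative]; push_cast; ring

theorem derivative_rescale (a : ℂ) (u : ℂ⟦X⟧) :
    𝐃 (PowerSeries.rescale a u) = 𝐂 a * PowerSeries.rescale a (𝐃 u) := by
  ext n
  simp only [PowerSeries.coeff_derivative, PowerSeries.coeff_rescale, coeff_C_mul']
  ring

theorem ne_zero_of_constantCoeff {u : ℂ⟦X⟧} (hu : cc u = 1) : u ≠ 0 := by
  rintro rfl; simp at hu

/-- A linear equation `y' = y a` has only the zero solution with zero initial value. -/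
theorem eq_zero_of_derivative_eq {y a : ℂ⟦X⟧} (h : 𝐃 y = y * a) (h0 : cc y = 0) :
    y = 0 := by
  ext n
  induction n using Nat.strong_induction_on with
  | _ n ih =>
    cases n with
    | zero => simpa using h0
    | succ n =>
      have h1 := congrArg (cf n) h
      rw [PowerSeries.coeff_derivative, PowerSeries.coeff_mul, Finset.sum_eq_zero] at h1
      · exact (mul_eq_zero.1 h1).resolve_right (by exact_mod_cast n.succ_ne_zero)
      · rintro ⟨i, j⟩ hij
        rw [Finset.HasAntidiagonal.mem_antidiagonal] at hij
        simp only at hij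
        simp [ih i (by omega)]

/-- Substitute u - 1 into (1 + x) (ln(1 + x))' = 1 and use the chain rule. -/
theorem mul_derivative_logOf {u : ℂ⟦X⟧} (hu : cc u = 1) :
    u * 𝐃 u.logOf = 𝐃 u := by
  have hs := hasSubst_sub_one hu
  have h : (1 + 𝐗) * 𝐃 (PowerSeries.log ℂ) = 1 := by
    rw [PowerSeries.deriv_log]
    ext n
    cases n with
    | zero => simp [add_mul]
    | succ n =>
      simp [add_mul, PowerSeries.coeff_succ_X_mul, PowerSeries.coeff_one, pow_succ]
  have h2 := congrArg (PowerSeries.subst (u - 1)) h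
  rw [← PowerSeries.coe_substAlgHom hs, map_mul, map_add, map_one, PowerSeries.substAlgHom_X,
    PowerSeries.coe_substAlgHom] at h2
  rw [PowerSeries.logOf_eq, PowerSeries.derivative_subst hs, map_sub]
  simp only [PowerSeries.derivative_one, sub_zero]
  rw [add_sub_cancel] at h2
  rw [← mul_assoc, h2, one_mul]

theorem derivative_logOf {u : ℂ⟦X⟧} (hu : cc u = 1) : 𝐃 u = u * 𝐃 u.logOf :=
  (mul_derivative_logOf hu).symm

/-- In characteristic zero a series is fixed by its derivative and constant term, so logarithms can
be identified without manipulating compositions. -/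
theorem eq_logOf {u l : ℂ⟦X⟧} (hu : cc u = 1) (hl : cc l = 0)
    (h : 𝐃 u = u * 𝐃 l) : l = u.logOf := by
  refine PowerSeries.derivative.ext ?_ (by rw [hl, PowerSeries.constantCoeff_logOf hu])
  exact mul_left_cancel₀ (ne_zero_of_constantCoeff hu) (by rw [← h, mul_derivative_logOf hu])

theorem one_add_X_mul_derivative_binomialSeries (s : ℂ) :
    (1 + 𝐗) * 𝐃 (PowerSeries.binomialSeries ℂ s) = 𝐂 s * PowerSeries.binomialSeries ℂ s := by
  have key : ∀ n : ℕ, Ring.choose s (n + 1) * (n + 1) = (s - n) * Ring.choose s n := by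
    intro n
    have e : ∀ d : ℕ, Ring.choose s d = (d.factorial : ℂ)⁻¹ * (descPochhammer ℂ d).eval s := by
      intro d
      rw [Ring.choose_eq_smul, Polynomial.descPochhammer_smeval_eq_ascPochhammer,
        Polynomial.ascPochhammer_smeval_eq_eval, smul_eq_mul,
        descPochhammer_eval_eq_ascPochhammer]
    rw [e, e, descPochhammer_succ_eval, Nat.factorial_succ]
    push_cast
    have h1 : (n : ℂ) + 1 ≠ 0 := by exact_mod_cast n.succ_ne_zero
    have h2 : (n.factorial : ℂ) ≠ 0 := by exact_mod_cast n.factorial_ne_zero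
    field_simp
  ext n
  cases n with
  | zero =>
    have h0 : cf 0 (𝐃 (PowerSeries.binomialSeries ℂ s)) = s := by
      simp only [PowerSeries.coeff_derivative, PowerSeries.binomialSeries_coeff]
      simp
    rw [PowerSeries.coeff_zero_eq_constantCoeff_apply] at h0
    simp [add_mul, h0]
  | succ n =>
    rw [add_mul, one_mul, map_add, PowerSeries.coeff_succ_X_mul, coeff_C_mul',
      PowerSeries.coeff_derivative, PowerSeries.coeff_derivative]
    simp only [PowerSeries.binomialSeries_coeff, smul_eq_mul, mul_one]
    have := key (n + 1)
    push_cast at this ⊢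
    rw [this]; ring

theorem derivative_onePow {u : ℂ⟦X⟧} (hu : cc u = 1) (s : ℂ) :
    𝐃 (onePow u s) = onePow u s * (𝐂 s * 𝐃 u.logOf) := by
  have hs := hasSubst_sub_one hu
  have h2 := congrArg (PowerSeries.subst (u - 1)) (one_add_X_mul_derivative_binomialSeries s)
  rw [← PowerSeries.coe_substAlgHom hs, map_mul, map_add, map_one, PowerSeries.substAlgHom_X,
    map_mul, PowerSeries.coe_substAlgHom, PowerSeries.subst_C, add_sub_cancel] at h2
  refine mul_left_cancel₀ (ne_zero_of_constantCoeff hu) ?_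
  have h3 : 𝐃 (u - 1) = 𝐃 u := by simp
  rw [onePow, PowerSeries.derivative_subst hs, h3, ← mul_assoc, h2, derivative_logOf hu]
  change 𝐂 s * _ * _ = _
  ring

/-- The exponential of a series without constant term. -/
def expOf (g : ℂ⟦X⟧) : ℂ⟦X⟧ := (PowerSeries.exp ℂ).subst g

theorem derivative_expOf {g : ℂ⟦X⟧} (hg : cc g = 0) :
    𝐃 (expOf g) = expOf g * 𝐃 g := by
  rw [expOf, PowerSeries.derivative_subst (PowerSeries.HasSubst.of_constantCoeff_zero' hg)]
  congr 2
  ext n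
  rw [PowerSeries.coeff_derivative]
  simp [PowerSeries.coeff_exp, Nat.factorial_succ]
  field_simp

theorem constantCoeff_subst' {g : ℂ⟦X⟧} (hg : cc g = 0) (u : ℂ⟦X⟧) :
    cc (u.subst g) = cc u := by
  have hs := PowerSeries.HasSubst.of_constantCoeff_zero' hg
  rw [← PowerSeries.coeff_zero_eq_constantCoeff_apply, PowerSeries.coeff_subst' hs,
    finsum_eq_single _ 0]
  · simp
  · intro d hd
    simp [hg, hd]

theorem constantCoeff_expOf {g : ℂ⟦X⟧} (hg : cc g = 0) :
    cc (expOf g) = 1 := by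
  rw [expOf, constantCoeff_subst' hg, PowerSeries.constantCoeff_exp]

theorem logOf_rescale {u : ℂ⟦X⟧} (hu : cc u = 1) (a : ℂ) :
    (PowerSeries.rescale a u).logOf = PowerSeries.rescale a u.logOf := by
  refine (eq_logOf ?_ ?_ ?_).symm
  · rw [← PowerSeries.coeff_zero_eq_constantCoeff_apply] at hu ⊢
    simpa [PowerSeries.coeff_rescale] using hu
  · have := PowerSeries.constantCoeff_logOf hu
    rw [← PowerSeries.coeff_zero_eq_constantCoeff_apply] at this ⊢
    simpa [PowerSeries.coeff_rescale] using this
  · rw [derivative_rescale, derivative_rescale, derivative_logOf hu, map_mul]; ring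

theorem derivative_mul_inv {u v : ℂ⟦X⟧} (hu : cc u = 1) (hv : cc v = 1) :
    𝐃 (u * v⁻¹) = u * v⁻¹ * 𝐃 (u.logOf - v.logOf) := by
  have h1 : v * v⁻¹ = 1 := PowerSeries.mul_inv_cancel v (by simp [hv])
  rw [derivative_mul, PowerSeries.derivative_inv', derivative_logOf hu, derivative_logOf hv,
    map_sub]
  linear_combination (-(u * v⁻¹ * 𝐃 v.logOf)) * h1

theorem constantCoeff_mul_inv {u v : ℂ⟦X⟧} (hu : cc u = 1) (hv : cc v = 1) :
    cc (u * v⁻¹) = 1 := by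
  simp [hu, hv, PowerSeries.constantCoeff_inv]

/-- An `𝐗`-adically continuous linear map is determined by its values on the powers of `𝐗`. -/
theorem coeff_eq_sum_of_order_raising (F : ℂ⟦X⟧ →ₗ[ℂ] ℂ⟦X⟧)
    (hF : ∀ (m : ℕ) (φ : ℂ⟦X⟧), 𝐗 ^ m ∣ F (𝐗 ^ m * φ)) (φ : ℂ⟦X⟧) (n : ℕ) :
    cf n (F φ) = ∑ j ∈ Finset.range (n + 1), cf j φ * cf n (F (𝐗 ^ j)) := by
  -- The tail x^(n+1)(⋯) has no effect on the coefficient of degree n, which leaves a polynomial and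
  -- plain linearity.
  have hφ := PowerSeries.eq_X_pow_mul_shift_add_trunc (n + 1) φ
  have h0 := PowerSeries.X_pow_dvd_iff.1
    (hF (n + 1) (PowerSeries.mk fun i => cf (i + (n + 1)) φ)) n (Nat.lt_succ_self n)
  have ht : ((PowerSeries.trunc (n + 1) φ : ℂ[X]) : ℂ⟦X⟧) =
      ∑ j ∈ Finset.range (n + 1), cf j φ • 𝐗 ^ j := by
    ext i
    simp [Polynomial.coeff_coe, PowerSeries.coeff_trunc, PowerSeries.coeff_X_pow]
  rw [ht] at hφ
  have h1 := congrArg (fun ψ => cf n (F ψ)) hφ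
  simp only [map_add, h0, zero_add, map_sum, map_smul, smul_eq_mul] at h1
  exact h1

/-! ### The series attached to `f` -/

theorem constantCoeff_omega {f : ℂ⟦X⟧} (hf : IsNormalized f) : cc (omega f hf) = 0 := by
  simp [omega]

theorem hasSubst_omega {f : ℂ⟦X⟧} (hf : IsNormalized f) : PowerSeries.HasSubst (omega f hf) :=
  PowerSeries.HasSubst.of_constantCoeff_zero' (constantCoeff_omega hf)

theorem constantCoeff_derivOmega {f : ℂ⟦X⟧} (hf : IsNormalized f) :
    cc (derivOmega f hf) = 1 := by
  rw [derivOmega, constantCoeff_subst' (constantCoeff_omega hf), constantCoeff_derivative hf]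

theorem X_mul_divX {f : ℂ⟦X⟧} (hf : IsNormalized f) : 𝐗 * divX f = f := by
  ext n
  cases n with
  | zero => simp [hf.constantCoeff_eq]
  | succ n => simp [PowerSeries.coeff_succ_X_mul, divX]

theorem constantCoeff_divX {f : ℂ⟦X⟧} (hf : IsNormalized f) : cc (divX f) = 1 := by
  rw [← PowerSeries.coeff_zero_eq_constantCoeff_apply]
  simp [divX, hf.coeff_one_eq]

/-- The series `x (ln (x / f))'`. -/
def eulerLog (f : ℂ⟦X⟧) : ℂ⟦X⟧ := 𝐗 * 𝐃 ((divX f)⁻¹).logOf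

/-- Logarithmic differentiation of x/f gives 1 - x (ln(x/f))' = x f'/f. -/
theorem logDerivInv_mul_one_sub_eulerLog {f : ℂ⟦X⟧} (hf : IsNormalized f) :
    logDerivInv f * (1 - eulerLog f) = 𝐗 := by
  have h1 := mul_derivative_logOf (constantCoeff_divX_inv hf)
  rw [PowerSeries.derivative_inv'] at h1
  have h2 : divX f * (divX f)⁻¹ = 1 :=
    PowerSeries.mul_inv_cancel _ (by simp [constantCoeff_divX hf])
  have h3 : 𝐃 f * (𝐃 f)⁻¹ = 1 :=
    PowerSeries.mul_inv_cancel _ (by simp [constantCoeff_derivative hf])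
  have h4 : 𝐃 f = divX f + 𝐗 * 𝐃 (divX f) := by
    conv_lhs => rw [← X_mul_divX hf, derivative_mul]
    simp
  have h5 : 𝐃 ((divX f)⁻¹).logOf = -((divX f)⁻¹ * 𝐃 (divX f)) := by
    linear_combination divX f * h1 +
      (-𝐃 ((divX f)⁻¹).logOf - (divX f)⁻¹ * 𝐃 (divX f)) * h2
  have h6 : 1 - eulerLog f = (divX f)⁻¹ * 𝐃 f := by
    rw [eulerLog, h5, h4]; linear_combination -h2
  rw [h6, logDerivInv]
  conv_lhs => enter [1, 1]; rw [← X_mul_divX hf]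
  linear_combination 𝐗 * divX f * (divX f)⁻¹ * h3 + 𝐗 * h2

/-- The series `1 - ω(x) / x`. -/
def eulerSaddle (f : ℂ⟦X⟧) (hf : IsNormalized f) : ℂ⟦X⟧ := (eulerLog f).subst (omega f hf)

/-- The saddle-point equation: the preceding identity evaluated at ω, where f/f' becomes x. -/
theorem X_mul_one_sub_eulerSaddle {f : ℂ⟦X⟧} (hf : IsNormalized f) :
    𝐗 * (1 - eulerSaddle f hf) = omega f hf := by
  have h := congrArg (PowerSeries.subst (omega f hf)) (logDerivInv_mul_one_sub_eulerLog hf)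
  rw [PowerSeries.subst_mul (hasSubst_omega hf), logDerivInv_subst_omega hf,
    PowerSeries.subst_sub (hasSubst_omega hf), PowerSeries.subst_X (hasSubst_omega hf)] at h
  rwa [← PowerSeries.coe_substAlgHom (hasSubst_omega hf), map_one,
    PowerSeries.coe_substAlgHom (hasSubst_omega hf)] at h

theorem constantCoeff_eulerSaddle {f : ℂ⟦X⟧} (hf : IsNormalized f) :
    cc (eulerSaddle f hf) = 0 := by
  rw [eulerSaddle, constantCoeff_subst' (constantCoeff_omega hf)]
  simp [eulerLog]

/-- The leading term of `ln p_s(s α) - s ln (s α)` is `s` times this series. -/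
def action (f : ℂ⟦X⟧) (hf : IsNormalized f) : ℂ⟦X⟧ :=
  PowerSeries.mk fun n => cf n (eulerSaddle f hf) / n

theorem constantCoeff_action {f : ℂ⟦X⟧} (hf : IsNormalized f) : cc (action f hf) = 0 := by
  rw [← PowerSeries.coeff_zero_eq_constantCoeff_apply]
  simp [action]

theorem X_mul_derivative_action {f : ℂ⟦X⟧} (hf : IsNormalized f) :
    𝐗 * 𝐃 (action f hf) = eulerSaddle f hf := by
  ext n
  rw [coeff_X_mul_derivative, action, PowerSeries.coeff_mk]
  cases n with
  | zero => simp [constantCoeff_eulerSaddle hf]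
  | succ n => field_simp

/-- By definition of ω, f(ω) = x f'(ω). Differentiate this and cancel f'(ω). -/
theorem X_mul_derivative_logOf_derivOmega {f : ℂ⟦X⟧} (hf : IsNormalized f) :
    𝐗 * 𝐃 (derivOmega f hf).logOf = 𝐃 (omega f hf) - 1 := by
  have hs := hasSubst_omega hf
  have h3 : 𝐃 f * (𝐃 f)⁻¹ = 1 :=
    PowerSeries.mul_inv_cancel _ (by simp [constantCoeff_derivative hf])
  have h1 : logDerivInv f * 𝐃 f = f := by
    rw [logDerivInv]; linear_combination f * h3
  have h2 := congrArg (PowerSeries.subst (omega f hf)) h1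
  rw [PowerSeries.subst_mul hs, logDerivInv_subst_omega hf] at h2
  have h4 := congrArg (𝐃) h2
  rw [PowerSeries.derivative_subst hs, derivative_mul, PowerSeries.derivative_X,
    ← derivOmega, derivative_logOf (constantCoeff_derivOmega hf)] at h4
  refine mul_left_cancel₀ (ne_zero_of_constantCoeff (constantCoeff_derivOmega hf)) ?_
  linear_combination h4

theorem constantCoeff_derivative_omega {f : ℂ⟦X⟧} (hf : IsNormalized f) :
    cc (𝐃 (omega f hf)) = 1 := by
  have h := congrArg cc (X_mul_derivative_logOf_derivOmega hf)
  simp only [map_mul, map_sub, map_one, PowerSeries.constantCoeff_X, zero_mul] at h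
  linear_combination -h

/-- Both sides vanish at 0, and x times either derivative is 1 - ω': on the left by differentiating
x (1 - x A') = ω, on the right by the preceding formula for ln f'(ω). -/
theorem derivative_X_mul_action {f : ℂ⟦X⟧} (hf : IsNormalized f) :
    𝐃 (𝐗 * action f hf) = -(derivOmega f hf).logOf := by
  refine PowerSeries.derivative.ext ?_ ?_
  · refine mul_left_cancel₀ (PowerSeries.X_ne_zero (R := ℂ)) ?_
    have h1 := congrArg (𝐃) (X_mul_one_sub_eulerSaddle hf)
    have h2 := X_mul_derivative_logOf_derivOmega hf
    have h3 := X_mul_derivative_action hf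
    rw [derivative_mul, map_sub] at h1
    simp only [PowerSeries.derivative_X, PowerSeries.derivative_one] at h1
    rw [derivative_mul, PowerSeries.derivative_X, h3, map_neg, map_add]
    simp only [one_mul]
    linear_combination h3 - h1 + h2
  · rw [derivative_mul]
    simp [constantCoeff_action hf,
      PowerSeries.constantCoeff_logOf (constantCoeff_derivOmega hf)]

theorem integral_logOf_derivOmega {f : ℂ⟦X⟧} (hf : IsNormalized f) :
    integral (derivOmega f hf).logOf = -(𝐗 * action f hf) := by
  have h := derivative_X_mul_action hf
  rw [← neg_eq_iff_eq_neg] at h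
  rw [← h]
  ext n
  rw [integral, PowerSeries.coeff_mk]
  cases n with
  | zero => simp
  | succ n =>
    rw [if_neg n.succ_ne_zero, Nat.add_sub_cancel, map_neg, map_neg, PowerSeries.coeff_derivative]
    push_cast
    field_simp

/-! ### The operator `x ^ k ↦ (1 - 1 / s) ⋯ (1 - k / s) x ^ k` -/

/-- The linear operator `x ^ k ↦ s ^ (-k) (s - 1) ⋯ (s - k) x ^ k`. -/
def fallScale (s : ℂ) : ℂ⟦X⟧ →ₗ[ℂ] ℂ⟦X⟧ where
  toFun φ := PowerSeries.mk fun k => s⁻¹ ^ k * (cf k φ * (descPochhammer ℂ k).eval (s - 1))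
  map_add' φ ψ := by ext k; simp; ring
  map_smul' a φ := by ext k; simp; ring

theorem coeff_fallScale (s : ℂ) (φ : ℂ⟦X⟧) (k : ℕ) :
    cf k (fallScale s φ) = s⁻¹ ^ k * (cf k φ * (descPochhammer ℂ k).eval (s - 1)) := by
  simp [fallScale]

theorem fallScale_onePow (f : ℂ⟦X⟧) (s : ℂ) :
    fallScale s (onePow (divX f)⁻¹ s) = PowerSeries.rescale s⁻¹ (pSeries f s) := by
  ext k
  rw [coeff_fallScale, PowerSeries.coeff_rescale, pSeries, PowerSeries.coeff_mk]

theorem X_mul_derivative_fallScale (s : ℂ) (φ : ℂ⟦X⟧) :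
    𝐗 * 𝐃 (fallScale s φ) = fallScale s (𝐗 * 𝐃 φ) := by
  ext k
  simp only [coeff_X_mul_derivative, coeff_fallScale]
  ring

/-- Passing from degree k to k + 1 costs the factor 1 - (k + 1)/s, and k + 1 is the eigenvalue of x
d/dx on x^(k+1). -/
theorem fallScale_X_mul {s : ℂ} (hs : s ≠ 0) (φ : ℂ⟦X⟧) :
    fallScale s (𝐗 * φ) =
      𝐗 * fallScale s φ - 𝐂 s⁻¹ * (𝐗 * 𝐃 (𝐗 * fallScale s φ)) := by
  ext k
  rw [map_sub, coeff_C_mul', coeff_X_mul_derivative, coeff_fallScale]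
  cases k with
  | zero => simp
  | succ k =>
    simp only [PowerSeries.coeff_succ_X_mul, coeff_fallScale, descPochhammer_succ_eval]
    push_cast
    have h : s⁻¹ * s = 1 := inv_mul_cancel₀ hs
    rw [pow_succ]
    linear_combination s⁻¹ ^ k * (cf k φ * (descPochhammer ℂ k).eval (s - 1)) * h

theorem X_pow_dvd_fallScale (s : ℂ) (m : ℕ) (φ : ℂ⟦X⟧) : 𝐗 ^ m ∣ fallScale s (𝐗 ^ m * φ) := by
  rw [PowerSeries.X_pow_dvd_iff]
  intro k hk
  rw [coeff_fallScale, PowerSeries.X_pow_dvd_iff.1 (dvd_mul_right _ φ) k hk]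
  simp

theorem constantCoeff_rescale (a : ℂ) (u : ℂ⟦X⟧) : cc (PowerSeries.rescale a u) = cc u := by
  rw [← PowerSeries.coeff_zero_eq_constantCoeff_apply, PowerSeries.coeff_rescale]
  simp

/-! ### The amplitude `e ^ (-s A) v_s` -/

/-- The series `v_s` with `p_s(s α) = (s α) ^ s v_s(α⁻¹)`. -/
def scaledP (f : ℂ⟦X⟧) (s : ℂ) : ℂ⟦X⟧ := PowerSeries.rescale s⁻¹ (pSeries f s)

theorem constantCoeff_scaledP {f : ℂ⟦X⟧} (hf : IsNormalized f) (s : ℂ) :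
    cc (scaledP f s) = 1 := by
  rw [scaledP, constantCoeff_rescale, constantCoeff_pSeries hf]

/-- The operator `ψ ↦ x (x ψ)'`. -/
def xEuler (ψ : ℂ⟦X⟧) : ℂ⟦X⟧ := 𝐗 * 𝐃 (𝐗 * ψ)

theorem coeff_zero_xEuler (ψ : ℂ⟦X⟧) : cf 0 (xEuler ψ) = 0 := by simp [xEuler]

theorem coeff_succ_xEuler (ψ : ℂ⟦X⟧) (n : ℕ) : cf (n + 1) (xEuler ψ) = (n + 1) * cf n ψ := by
  rw [xEuler, coeff_X_mul_derivative, PowerSeries.coeff_succ_X_mul]; push_cast; rfl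

theorem xEuler_add (φ ψ : ℂ⟦X⟧) : xEuler (φ + ψ) = xEuler φ + xEuler ψ := by
  simp only [xEuler, mul_add, map_add]

theorem xEuler_C_mul (a : ℂ) (ψ : ℂ⟦X⟧) : xEuler (𝐂 a * ψ) = 𝐂 a * xEuler ψ := by
  simp only [xEuler, derivative_mul, PowerSeries.derivative_C, PowerSeries.derivative_X]; ring

theorem xEuler_mul (φ ψ : ℂ⟦X⟧) : xEuler (φ * ψ) = φ * xEuler ψ + 𝐗 ^ 2 * 𝐃 φ * ψ := by
  simp only [xEuler, derivative_mul, PowerSeries.derivative_X]; ring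

variable {f : ℂ⟦X⟧} (hf : IsNormalized f)

/-- The factor `e ^ (-s A)`. -/
def phase (hf : IsNormalized f) (s : ℂ) : ℂ⟦X⟧ := expOf (-(𝐂 s * action f hf))

theorem constantCoeff_phase (s : ℂ) : cc (phase hf s) = 1 :=
  constantCoeff_expOf (by simp [constantCoeff_action hf])

theorem derivative_phase (s : ℂ) :
    𝐃 (phase hf s) = phase hf s * -(𝐂 s * 𝐃 (action f hf)) := by
  rw [phase, derivative_expOf (by simp [constantCoeff_action hf])]
  simp

/-- The linear operator `h ↦ e ^ (-s A) T_s ((x / f) ^ s h)`, where `T_s` is `fallScale s`. -/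
def moment (hf : IsNormalized f) (s : ℂ) : ℂ⟦X⟧ →ₗ[ℂ] ℂ⟦X⟧ :=
  LinearMap.mulLeft ℂ (phase hf s) ∘ₗ fallScale s ∘ₗ
    LinearMap.mulRight ℂ (onePow (divX f)⁻¹ s)

theorem moment_apply (s : ℂ) (φ : ℂ⟦X⟧) :
    moment hf s φ = phase hf s * fallScale s (φ * onePow (divX f)⁻¹ s) := by
  simp [moment]

theorem X_pow_dvd_moment (s : ℂ) (m : ℕ) (φ : ℂ⟦X⟧) : 𝐗 ^ m ∣ moment hf s (𝐗 ^ m * φ) := by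
  rw [moment_apply, mul_assoc]
  exact (X_pow_dvd_fallScale s m _).mul_left _

theorem moment_one (s : ℂ) : moment hf s 1 = phase hf s * scaledP f s := by
  rw [moment_apply, one_mul, fallScale_onePow, scaledP]

theorem constantCoeff_moment_one (s : ℂ) : cc (moment hf s 1) = 1 := by
  rw [moment_one, map_mul, constantCoeff_phase, constantCoeff_scaledP hf, one_mul]

/-- This dictates the choice of A: moving e^(-sA) through s⁻¹ x (x ·)' produces -x² A', which turns
the factor x into x (1 - x A') = ω. -/
theorem moment_X_mul {s : ℂ} (hs : s ≠ 0) (φ : ℂ⟦X⟧) :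
    moment hf s (𝐗 * φ) =
      omega f hf * moment hf s φ - 𝐂 s⁻¹ * xEuler (moment hf s φ) := by
  have h1 : 𝐂 s⁻¹ * 𝐂 s = 1 := by rw [← map_mul, inv_mul_cancel₀ hs, map_one]
  rw [moment_apply, moment_apply, mul_assoc, fallScale_X_mul hs, ← X_mul_one_sub_eulerSaddle hf,
    ← X_mul_derivative_action hf]
  set Y := fallScale s (φ * onePow (divX f)⁻¹ s)
  simp only [xEuler, derivative_mul, PowerSeries.derivative_X, derivative_phase hf]
  linear_combination (-𝐗 * 𝐗 * 𝐃 (action f hf) * phase hf s * Y) * h1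

/-- The operator x d/dx commutes with T_s. On (x/f)^s it brings down s φ, with φ the series
`eulerLog f`, and on the phase -s x A' = -s φ(ω). -/
theorem X_mul_derivative_moment_one (s : ℂ) :
    𝐗 * 𝐃 (moment hf s 1) =
      𝐂 s * (moment hf s (eulerLog f) - eulerSaddle f hf * moment hf s 1) := by
  have h1 : 𝐗 * 𝐃 (onePow (divX f)⁻¹ s) = s • (eulerLog f * onePow (divX f)⁻¹ s) := by
    rw [derivative_onePow (constantCoeff_divX_inv hf), eulerLog, PowerSeries.smul_eq_C_mul]; ring
  have h2 := X_mul_derivative_fallScale s (onePow (divX f)⁻¹ s)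
  rw [h1, map_smul, PowerSeries.smul_eq_C_mul] at h2
  rw [moment_apply, moment_apply, one_mul, derivative_mul, derivative_phase hf,
    ← X_mul_derivative_action hf]
  linear_combination phase hf s * h2

/-- The deviation `s (W_j - ω ^ j W_0)`, where `W_j = moment (x ^ j)`. -/
def deviation (hf : IsNormalized f) (s : ℂ) (j : ℕ) : ℂ⟦X⟧ :=
  𝐂 s * (moment hf s (𝐗 ^ j) - omega f hf ^ j * moment hf s 1)

theorem deviation_zero (s : ℂ) : deviation hf s 0 = 0 := by simp [deviation]

/-- Insert W_j = ω^j W_0 + s⁻¹ (deviation) into the recursion for the moments: the terms of order s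
cancel, so no positive power of s survives. -/
theorem deviation_succ {s : ℂ} (hs : s ≠ 0) (j : ℕ) :
    deviation hf s (j + 1) = omega f hf * deviation hf s j -
      xEuler (omega f hf ^ j * moment hf s 1) - 𝐂 s⁻¹ * xEuler (deviation hf s j) := by
  have h1 : 𝐂 s⁻¹ * 𝐂 s = 1 := by rw [← map_mul, inv_mul_cancel₀ hs, map_one]
  have h2 : moment hf s (𝐗 ^ j) =
      omega f hf ^ j * moment hf s 1 + 𝐂 s⁻¹ * deviation hf s j := by
    rw [deviation]
    linear_combination (-(moment hf s (𝐗 ^ j)) + omega f hf ^ j * moment hf s 1) * h1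
  have h3 : xEuler (moment hf s (𝐗 ^ j)) =
      xEuler (omega f hf ^ j * moment hf s 1) + 𝐂 s⁻¹ * xEuler (deviation hf s j) := by
    rw [h2, xEuler_add, xEuler_C_mul]
  have h4 : deviation hf s j =
      𝐂 s * (moment hf s (𝐗 ^ j) - omega f hf ^ j * moment hf s 1) := rfl
  have h5 : deviation hf s (j + 1) =
      𝐂 s * (moment hf s (𝐗 * 𝐗 ^ j) - omega f hf ^ (j + 1) * moment hf s 1) := by
    rw [deviation, pow_succ' 𝐗]
  rw [h5, moment_X_mul hf hs, h3]
  linear_combination (-xEuler (omega f hf ^ j * moment hf s 1) -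
    𝐂 s⁻¹ * xEuler (deviation hf s j)) * h1 - omega f hf * h4

/-- The operator `φ ↦ φ(ω) ψ`. -/
def substMul (hf : IsNormalized f) (ψ : ℂ⟦X⟧) : ℂ⟦X⟧ →ₗ[ℂ] ℂ⟦X⟧ :=
  LinearMap.mulRight ℂ ψ ∘ₗ
    (PowerSeries.substAlgHom (R := ℂ) (hasSubst_omega hf)).toLinearMap

theorem substMul_apply (ψ φ : ℂ⟦X⟧) :
    substMul hf ψ φ = φ.subst (omega f hf) * ψ := by
  simp [substMul, PowerSeries.coe_substAlgHom]

theorem X_pow_dvd_subst_omega (m : ℕ) (φ : ℂ⟦X⟧) :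
    𝐗 ^ m ∣ (𝐗 ^ m * φ).subst (omega f hf) := by
  rw [PowerSeries.subst_mul (hasSubst_omega hf), PowerSeries.subst_pow (hasSubst_omega hf),
    PowerSeries.subst_X (hasSubst_omega hf)]
  exact (pow_dvd_pow_of_dvd (PowerSeries.X_dvd_iff.2 (constantCoeff_omega hf)) m).mul_right _

/-- Both terms of `X_mul_derivative_moment_one` are expanded along the powers of x in `eulerLog f`.
Powers beyond x^n do not reach degree n. -/
theorem coeff_X_mul_derivative_moment_one (s : ℂ) (n : ℕ) :
    n * cf n (moment hf s 1) =
      ∑ j ∈ Finset.range (n + 1), cf j (eulerLog f) * cf n (deviation hf s j) := by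
  rw [← coeff_X_mul_derivative, X_mul_derivative_moment_one, coeff_C_mul', map_sub,
    coeff_eq_sum_of_order_raising _ (X_pow_dvd_moment hf s), eulerSaddle,
    ← substMul_apply hf, coeff_eq_sum_of_order_raising (substMul hf (moment hf s 1)),
    ← Finset.sum_sub_distrib, Finset.mul_sum]
  · refine Finset.sum_congr rfl fun j _ => ?_
    rw [deviation, coeff_C_mul', map_sub, substMul_apply,
      PowerSeries.subst_pow (hasSubst_omega hf), PowerSeries.subst_X (hasSubst_omega hf)]
    ring
  · intro m φ
    rw [substMul_apply]
    exact (X_pow_dvd_subst_omega hf m φ).mul_right _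

/-! ### Polynomial dependence on `1 / s` and limits -/

/-- A function of `s` that is a polynomial in `1 / s` for `s ≠ 0`. -/
def IsInvPoly (g : ℂ → ℂ) : Prop := ∃ P : ℂ[X], ∀ s ≠ 0, g s = P.eval s⁻¹

theorem IsInvPoly.const (a : ℂ) : IsInvPoly fun _ => a := ⟨Polynomial.C a, by simp⟩

theorem IsInvPoly.inv : IsInvPoly fun s => s⁻¹ := ⟨Polynomial.X, by simp⟩

theorem IsInvPoly.add {g h : ℂ → ℂ} (hg : IsInvPoly g) (hh : IsInvPoly h) :
    IsInvPoly fun s => g s + h s := by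
  obtain ⟨P, hP⟩ := hg
  obtain ⟨Q, hQ⟩ := hh
  exact ⟨P + Q, fun s hs => by simp only [hP s hs, hQ s hs, Polynomial.eval_add]⟩

theorem IsInvPoly.mul {g h : ℂ → ℂ} (hg : IsInvPoly g) (hh : IsInvPoly h) :
    IsInvPoly fun s => g s * h s := by
  obtain ⟨P, hP⟩ := hg
  obtain ⟨Q, hQ⟩ := hh
  exact ⟨P * Q, fun s hs => by simp only [hP s hs, hQ s hs, Polynomial.eval_mul]⟩

theorem IsInvPoly.sub {g h : ℂ → ℂ} (hg : IsInvPoly g) (hh : IsInvPoly h) :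
    IsInvPoly fun s => g s - h s := by
  simpa [sub_eq_add_neg] using hg.add ((IsInvPoly.const (-1)).mul hh)

theorem IsInvPoly.sum {ι : Type*} (S : Finset ι) {g : ι → ℂ → ℂ}
    (hg : ∀ i ∈ S, IsInvPoly (g i)) : IsInvPoly fun s => ∑ i ∈ S, g i s := by
  classical
  induction S using Finset.induction_on with
  | empty => simpa using IsInvPoly.const 0
  | insert a S ha ih =>
    simp only [Finset.sum_insert ha]
    exact (hg a (Finset.mem_insert_self a S)).add
      (ih fun i hi => hg i (Finset.mem_insert_of_mem hi))

theorem IsInvPoly.congr {g h : ℂ → ℂ} (hg : IsInvPoly g) (e : ∀ s ≠ 0, h s = g s) :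
    IsInvPoly h := by
  obtain ⟨P, hP⟩ := hg
  exact ⟨P, fun s hs => by rw [e s hs, hP s hs]⟩

theorem IsInvPoly.coeff_mul {a b : ℂ → ℂ⟦X⟧} {n : ℕ}
    (ha : ∀ m ≤ n, IsInvPoly fun s => cf m (a s)) (hb : ∀ m ≤ n, IsInvPoly fun s => cf m (b s)) :
    IsInvPoly fun s => cf n (a s * b s) := by
  simp only [PowerSeries.coeff_mul]
  refine IsInvPoly.sum _ fun i hi => ?_
  rw [Finset.HasAntidiagonal.mem_antidiagonal] at hi
  exact (ha _ (by omega)).mul (hb _ (by omega))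

theorem tendsto_inv_cobounded : Tendsto (fun s : ℂ => s⁻¹) (Bornology.cobounded ℂ) (𝓝 0) :=
  tendsto_inv₀_cobounded

theorem eventually_ne_zero : ∀ᶠ s : ℂ in Bornology.cobounded ℂ, s ≠ 0 :=
  Bornology.eventually_ne_cobounded 0

/-- Coefficientwise convergence as `s → ∞`. -/
def CoeffLim (a : ℂ → ℂ⟦X⟧) (b : ℂ⟦X⟧) : Prop :=
  ∀ n, Tendsto (fun s => cf n (a s)) (Bornology.cobounded ℂ) (𝓝 (cf n b))

theorem CoeffLim.const (b : ℂ⟦X⟧) : CoeffLim (fun _ => b) b := fun _ => tendsto_const_nhds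

theorem CoeffLim.add {a b : ℂ → ℂ⟦X⟧} {a' b' : ℂ⟦X⟧} (ha : CoeffLim a a') (hb : CoeffLim b b') :
    CoeffLim (fun s => a s + b s) (a' + b') := fun n => by
  simpa only [map_add] using (ha n).add (hb n)

theorem CoeffLim.sub {a b : ℂ → ℂ⟦X⟧} {a' b' : ℂ⟦X⟧} (ha : CoeffLim a a') (hb : CoeffLim b b') :
    CoeffLim (fun s => a s - b s) (a' - b') := fun n => by
  simpa only [map_sub] using (ha n).sub (hb n)

theorem CoeffLim.mul {a b : ℂ → ℂ⟦X⟧} {a' b' : ℂ⟦X⟧} (ha : CoeffLim a a') (hb : CoeffLim b b') :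
    CoeffLim (fun s => a s * b s) (a' * b') := fun n => by
  simp only [PowerSeries.coeff_mul]
  exact tendsto_finsetSum _ fun i _ => (ha _).mul (hb _)

theorem CoeffLim.derivative {a : ℂ → ℂ⟦X⟧} {a' : ℂ⟦X⟧} (ha : CoeffLim a a') :
    CoeffLim (fun s => 𝐃 (a s)) (𝐃 a') := fun n => by
  simp only [PowerSeries.coeff_derivative]
  exact (ha _).mul_const _

theorem CoeffLim.xEuler {a : ℂ → ℂ⟦X⟧} {a' : ℂ⟦X⟧} (ha : CoeffLim a a') :
    CoeffLim (fun s => xEuler (a s)) (xEuler a') :=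
  (CoeffLim.const _).mul ((CoeffLim.const _).mul ha).derivative

theorem CoeffLim.congr' {a b : ℂ → ℂ⟦X⟧} {a' : ℂ⟦X⟧} (ha : CoeffLim a a')
    (e : ∀ s ≠ 0, b s = a s) : CoeffLim b a' := fun n =>
  (ha n).congr' (eventually_ne_zero.mono fun s hs => by simp only [e s hs])

theorem CoeffLim.unique {a : ℂ → ℂ⟦X⟧} {b c : ℂ⟦X⟧} (hb : CoeffLim a b) (hc : CoeffLim a c) :
    b = c := by
  ext n
  exact tendsto_nhds_unique (hb n) (hc n)

theorem coeffLim_C_inv : CoeffLim (fun s => 𝐂 s⁻¹) 0 := fun n => by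
  simp only [PowerSeries.coeff_C]
  split_ifs
  · simpa using tendsto_inv_cobounded
  · simp

theorem exists_coeffLim_of_isInvPoly {a : ℂ → ℂ⟦X⟧} (ha : ∀ n, IsInvPoly fun s => cf n (a s)) :
    ∃ q : ℕ → ℂ[X], (∀ s ≠ 0, ∀ n, cf n (a s) = (q n).eval s⁻¹) ∧
      CoeffLim a (PowerSeries.mk fun n => (q n).eval 0) := by
  choose q hq using ha
  refine ⟨q, fun s hs n => hq n s hs, fun n => ?_⟩
  rw [PowerSeries.coeff_mk]
  exact (((q n).continuous.tendsto 0).comp tendsto_inv_cobounded).congr'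
    (eventually_ne_zero.mono fun s hs => (hq n s hs).symm)

/-- `xEuler` raises degrees by one, so W_0 enters only in degrees strictly below n. This strictness
is what closes the induction for W_0 itself. -/
theorem isInvPoly_coeff_deviation {n : ℕ}
    (h : ∀ m < n, IsInvPoly fun s => cf m (moment hf s 1)) (j : ℕ) :
    ∀ m ≤ n, IsInvPoly fun s => cf m (deviation hf s j) := by
  induction j with
  | zero => intro m _; simpa [deviation_zero] using IsInvPoly.const 0
  | succ j ih =>
    intro m hm
    refine IsInvPoly.congr (g := fun s => cf m (omega f hf * deviation hf s j) -
      cf m (xEuler (omega f hf ^ j * moment hf s 1)) - s⁻¹ * cf m (xEuler (deviation hf s j)))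
      ?_ fun s hs => by rw [deviation_succ hf hs, map_sub, map_sub, coeff_C_mul']
    have h1 : IsInvPoly fun s => cf m (omega f hf * deviation hf s j) :=
      IsInvPoly.coeff_mul (fun k _ => IsInvPoly.const _) fun k hk => ih k (hk.trans hm)
    cases m with
    | zero => simpa [coeff_zero_xEuler] using h1
    | succ m =>
      simp only [coeff_succ_xEuler]
      refine (h1.sub ((IsInvPoly.const _).mul ?_)).sub
        (IsInvPoly.inv.mul ((IsInvPoly.const _).mul (ih m (by omega))))
      exact IsInvPoly.coeff_mul (fun k _ => IsInvPoly.const _) fun k hk => h k (by omega)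

theorem isInvPoly_coeff_moment_one (n : ℕ) : IsInvPoly fun s => cf n (moment hf s 1) := by
  induction n using Nat.strong_induction_on with
  | _ n ih =>
    rcases Nat.eq_zero_or_pos n with rfl | hn
    · simpa [constantCoeff_moment_one] using IsInvPoly.const 1
    · have hn' : (n : ℂ) ≠ 0 := by exact_mod_cast hn.ne'
      refine IsInvPoly.congr (g := fun s => (n : ℂ)⁻¹ *
        ∑ j ∈ Finset.range (n + 1), cf j (eulerLog f) * cf n (deviation hf s j)) ?_ fun s _ => ?_
      · exact (IsInvPoly.const _).mul (IsInvPoly.sum _ fun j _ => (IsInvPoly.const _).mul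
          (isInvPoly_coeff_deviation hf ih j n le_rfl))
      · rw [← coeff_X_mul_derivative_moment_one, inv_mul_cancel_left₀ hn']

/-- As the constant term is 1, u' = u (ln u)' determines the coefficients of (ln u)' recursively
without division by functions of s. -/
theorem isInvPoly_coeff_logOf {u : ℂ → ℂ⟦X⟧} (hu : ∀ s, cc (u s) = 1)
    (h : ∀ n, IsInvPoly fun s => cf n (u s)) (n : ℕ) :
    IsInvPoly fun s => cf n (u s).logOf := by
  have key : ∀ n : ℕ, IsInvPoly fun s => cf n (𝐃 (u s).logOf) := by
    intro n
    induction n using Nat.strong_induction_on with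
    | _ n ih =>
      refine IsInvPoly.congr (g := fun s => cf n (𝐃 (u s)) -
        ∑ i ∈ Finset.range n, cf (n - i) (u s) * cf i (𝐃 (u s).logOf)) ?_ fun s _ => ?_
      · simp only [PowerSeries.coeff_derivative]
        refine ((h _).mul (IsInvPoly.const _)).sub (IsInvPoly.sum _ fun i hi => ?_)
        have := ih i (Finset.mem_range.1 hi)
        simp only [PowerSeries.coeff_derivative] at this
        exact (h _).mul this
      · conv_rhs => rw [derivative_logOf (hu s)]
        rw [mul_comm, PowerSeries.coeff_mul, Finset.Nat.sum_antidiagonal_eq_sum_range_succ_mk,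
          Finset.sum_range_succ]
        simp [hu s, mul_comm]
  cases n with
  | zero => simpa [PowerSeries.constantCoeff_logOf (hu _)] using IsInvPoly.const 0
  | succ n =>
    have hn : (n : ℂ) + 1 ≠ 0 := by exact_mod_cast n.succ_ne_zero
    refine ((key n).mul (IsInvPoly.const ((n : ℂ) + 1)⁻¹)).congr fun s _ => ?_
    rw [PowerSeries.coeff_derivative, mul_inv_cancel_right₀ hn]

/-! ### The limit of the amplitude -/

/-- The limit of `deviation hf s j` is the value at `x ^ j` of
`φ ↦ -(φ'(ω) x (x K)' + φ''(ω) x ^ 2 ω' K / 2)`. -/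
def limitOp (hf : IsNormalized f) (K : ℂ⟦X⟧) : ℂ⟦X⟧ →ₗ[ℂ] ℂ⟦X⟧ :=
  -(substMul hf (xEuler K) ∘ₗ (𝐃).toLinearMap +
    substMul hf (𝐂 (1 / 2) * 𝐗 ^ 2 * 𝐃 (omega f hf) * K) ∘ₗ (𝐃).toLinearMap ∘ₗ (𝐃).toLinearMap)

theorem limitOp_apply (K φ : ℂ⟦X⟧) :
    limitOp hf K φ = -((𝐃 φ).subst (omega f hf) * xEuler K +
      (𝐃 (𝐃 φ)).subst (omega f hf) * (𝐂 (1 / 2) * 𝐗 ^ 2 * 𝐃 (omega f hf) * K)) := by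
  simp [limitOp, substMul_apply]

theorem X_pow_dvd_derivative_X_pow_mul (m : ℕ) (φ : ℂ⟦X⟧) : 𝐗 ^ m ∣ 𝐃 (𝐗 ^ (m + 1) * φ) := by
  rw [derivative_mul, PowerSeries.derivative_pow, Nat.add_sub_cancel]
  exact dvd_add (((dvd_mul_left _ _).mul_right _).mul_right _)
    (((pow_dvd_pow _ (Nat.le_succ m)).mul_right _))

theorem X_pow_dvd_limitOp (K : ℂ⟦X⟧) (m : ℕ) (φ : ℂ⟦X⟧) :
    𝐗 ^ m ∣ limitOp hf K (𝐗 ^ m * φ) := by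
  have hsub : ∀ (k : ℕ) (ψ : ℂ⟦X⟧), 𝐗 ^ k ∣ ψ → 𝐗 ^ k ∣ ψ.subst (omega f hf) := by
    rintro k _ ⟨χ, rfl⟩
    exact X_pow_dvd_subst_omega hf k χ
  have hD : ∀ (k : ℕ) (ψ : ℂ⟦X⟧), 𝐗 ^ k ∣ ψ → 𝐗 ^ (k - 1) ∣ 𝐃 ψ := by
    rintro k _ ⟨χ, rfl⟩
    cases k with
    | zero => simp
    | succ k => exact X_pow_dvd_derivative_X_pow_mul k χ
  have h1 := hD m _ (dvd_mul_right (𝐗 ^ m) φ)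
  have h2 := hD _ _ h1
  rw [limitOp_apply, dvd_neg]
  refine dvd_add ?_ ?_
  -- Each derivative loses at most one order, regained from the factor x in `xEuler K` here and from
  -- x² in the second term. Truncated subtraction covers small m.
  · refine (pow_dvd_pow 𝐗 (show m ≤ (m - 1) + 1 by omega)).trans ?_
    rw [pow_add, pow_one]
    exact mul_dvd_mul (hsub _ _ h1) (dvd_mul_right _ _)
  · refine (pow_dvd_pow 𝐗 (show m ≤ (m - 1 - 1) + 2 by omega)).trans ?_
    rw [pow_add]
    exact mul_dvd_mul (hsub _ _ h2) (((dvd_mul_left _ _).mul_right _).mul_right _)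

/-- This is the recursion of the deviations with its s⁻¹ term dropped. The constant ½ fits because
(xφ)'' contains 2φ'. -/
theorem limitOp_X_mul (K φ : ℂ⟦X⟧) :
    limitOp hf K (𝐗 * φ) =
      omega f hf * limitOp hf K φ - xEuler (φ.subst (omega f hf) * K) := by
  have hs := hasSubst_omega hf
  have h2 : 𝐂 (1 / 2) * 2 = 1 := by
    rw [show (2 : ℂ⟦X⟧) = 𝐂 2 from (map_ofNat _ 2).symm, ← map_mul]; norm_num
  have e1 : 𝐃 (𝐗 * φ) = φ + 𝐗 * 𝐃 φ := by rw [derivative_mul, PowerSeries.derivative_X, one_mul]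
  have e2 : 𝐃 (𝐃 (𝐗 * φ)) = 𝐃 φ + 𝐃 φ + 𝐗 * 𝐃 (𝐃 φ) := by
    rw [e1, map_add, derivative_mul, PowerSeries.derivative_X, one_mul, add_assoc]
  rw [limitOp_apply, limitOp_apply, e2, e1, xEuler_mul, PowerSeries.derivative_subst hs]
  simp only [PowerSeries.subst_add hs, PowerSeries.subst_mul hs, PowerSeries.subst_X hs]
  linear_combination (-(𝐃 φ).subst (omega f hf) * 𝐗 ^ 2 * 𝐃 (omega f hf) * K) * h2

theorem coeffLim_deviation {K : ℂ⟦X⟧} (hK : CoeffLim (fun s => moment hf s 1) K) (j : ℕ) :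
    CoeffLim (fun s => deviation hf s j) (limitOp hf K (𝐗 ^ j)) := by
  have hs := hasSubst_omega hf
  induction j with
  | zero =>
    have h : limitOp hf K (𝐗 ^ 0) = 0 := by
      rw [limitOp_apply, pow_zero, PowerSeries.derivative_one, map_zero,
        ← PowerSeries.coe_substAlgHom hs, map_zero]
      ring
    rw [h]
    exact (CoeffLim.const 0).congr' fun s _ => deviation_zero hf s
  | succ j ih =>
    rw [pow_succ', limitOp_X_mul, PowerSeries.subst_pow hs, PowerSeries.subst_X hs]
    have := (((CoeffLim.const (omega f hf)).mul ih).sub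
      ((CoeffLim.const (omega f hf ^ j)).mul hK).xEuler).sub (coeffLim_C_inv.mul ih.xEuler)
    rw [zero_mul, sub_zero] at this
    exact this.congr' fun s hs => deviation_succ hf hs j

/-- In each degree the equation for x W_0' is a finite sum of deviations; pass to the limit termwise
and resum by linearity. -/
theorem X_mul_derivative_of_coeffLim {K : ℂ⟦X⟧} (hK : CoeffLim (fun s => moment hf s 1) K) :
    𝐗 * 𝐃 K = limitOp hf K (eulerLog f) := by
  refine ((CoeffLim.const 𝐗).mul hK.derivative).unique fun n => ?_
  rw [coeff_eq_sum_of_order_raising _ (X_pow_dvd_limitOp hf K)]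
  simp only [coeff_X_mul_derivative, coeff_X_mul_derivative_moment_one]
  exact tendsto_finsetSum _ fun j _ => (coeffLim_deviation hf hK j n).const_mul _

/-- The limit `K` of the amplitude satisfies `2 ω' K' = ω'' K`. -/
theorem derivative_of_coeffLim {K : ℂ⟦X⟧} (hK : CoeffLim (fun s => moment hf s 1) K) :
    2 * 𝐃 (omega f hf) * 𝐃 K = 𝐃 (𝐃 (omega f hf)) * K := by
  have hs := hasSubst_omega hf
  have h2 : 𝐂 (1 / 2) * 2 = 1 := by
    rw [show (2 : ℂ⟦X⟧) = 𝐂 2 from (map_ofNat _ 2).symm, ← map_mul]; norm_num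
  have h := X_mul_derivative_of_coeffLim hf hK
  rw [limitOp_apply] at h
  -- With a = φ'(ω) and b = φ''(ω), this says (1 + x a) ω'' = -2 a ω' - x b ω'². The limit equation
  -- reads (1 + x a) K' = -(a + ½ x b ω') K after removing x, and the two right sides match up to 2
  -- ω' and K.
  have hγ := congrArg (fun u => 𝐃 (𝐃 u)) (X_mul_one_sub_eulerSaddle hf)
  simp only [eulerSaddle, derivative_mul, map_sub, map_add, PowerSeries.derivative_X,
    PowerSeries.derivative_one, map_zero, PowerSeries.derivative_subst hs] at hγ
  set a := (𝐃 (eulerLog f)).subst (omega f hf)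
  set b := (𝐃 (𝐃 (eulerLog f))).subst (omega f hf)
  have hu : 1 + 𝐗 * a ≠ 0 := fun h0 => by
    have := congrArg cc h0
    simp at this
  refine mul_left_cancel₀ (mul_ne_zero PowerSeries.X_ne_zero hu) ?_
  simp only [xEuler, derivative_mul, PowerSeries.derivative_X] at h
  linear_combination 2 * 𝐃 (omega f hf) * h + 𝐗 * K * hγ -
    b * 𝐗 ^ 2 * 𝐃 (omega f hf) ^ 2 * K * h2

/-- `ln v_s = s A + ½ ln ω' + O(1 / s)`, with coefficients that are polynomials in `1 / s` up to
the leading term. -/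
theorem exists_logOf_scaledP : ∃ q : ℕ → ℂ[X],
    (∀ s ≠ 0, ∀ n, cf n (scaledP f s).logOf = s * cf n (action f hf) + (q n).eval s⁻¹) ∧
    ∀ n, (q n).eval 0 = 1 / 2 * cf n (𝐃 (omega f hf)).logOf := by
  have hlog : ∀ s, (scaledP f s).logOf = 𝐂 s * action f hf + (moment hf s 1).logOf := by
    intro s
    refine (eq_logOf (constantCoeff_scaledP hf s) ?_ ?_).symm
    · simp [constantCoeff_action hf, PowerSeries.constantCoeff_logOf (constantCoeff_moment_one hf s)]
    · have h := derivative_logOf (constantCoeff_moment_one hf s)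
      have hp := ne_zero_of_constantCoeff (constantCoeff_phase hf s)
      refine mul_left_cancel₀ hp ?_
      conv_lhs at h => rw [moment_one, derivative_mul, derivative_phase]
      conv_rhs at h => enter [1]; rw [moment_one]
      rw [map_add, derivative_mul, PowerSeries.derivative_C]
      linear_combination h
  obtain ⟨k, -, hk⟩ := exists_coeffLim_of_isInvPoly (isInvPoly_coeff_moment_one hf)
  obtain ⟨q, hq, hl⟩ := exists_coeffLim_of_isInvPoly
    (isInvPoly_coeff_logOf (constantCoeff_moment_one hf) (isInvPoly_coeff_moment_one hf))
  set K := PowerSeries.mk fun n => (k n).eval 0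
  set L := PowerSeries.mk fun n => (q n).eval 0
  have hcK : cc K = 1 := by
    rw [← PowerSeries.coeff_zero_eq_constantCoeff_apply]
    refine tendsto_nhds_unique (hk 0) ?_
    simp [constantCoeff_moment_one]
  have hcL : cc L = 0 := by
    rw [← PowerSeries.coeff_zero_eq_constantCoeff_apply]
    refine tendsto_nhds_unique (hl 0) ?_
    simp [PowerSeries.constantCoeff_logOf (constantCoeff_moment_one hf _)]
  have hKL : 𝐃 K = K * 𝐃 L := by
    refine hk.derivative.unique ((hk.mul hl.derivative).congr' fun s _ => ?_)
    exact derivative_logOf (constantCoeff_moment_one hf s)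
  have hw := constantCoeff_derivative_omega hf
  have hL : L = 𝐂 (1 / 2) * (𝐃 (omega f hf)).logOf := by
    refine PowerSeries.derivative.ext ?_ (by simp [hcL, PowerSeries.constantCoeff_logOf hw])
    have h2 : 𝐂 (1 / 2) * 2 = 1 := by
      rw [show (2 : ℂ⟦X⟧) = 𝐂 2 from (map_ofNat _ 2).symm, ← map_mul]; norm_num
    have h := derivative_of_coeffLim hf hk
    rw [hKL, derivative_logOf hw] at h
    -- With K' = K L', the equation 2 ω' K' = ω'' K reduces to 2 L' = (ln ω')' after cancelling ω'
    -- K.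
    have h3 := mul_left_cancel₀
      (mul_ne_zero (ne_zero_of_constantCoeff hw) (ne_zero_of_constantCoeff hcK))
      (show _ * (2 * 𝐃 L) = _ * 𝐃 (𝐃 (omega f hf)).logOf by linear_combination h)
    rw [derivative_mul, PowerSeries.derivative_C]
    linear_combination 𝐂 (1 / 2) * h3 - 𝐃 L * h2
  refine ⟨q, fun s hs n => ?_, fun n => ?_⟩
  · rw [hlog, map_add, coeff_C_mul', hq s hs]
  · have := congrArg (cf n) hL
    rwa [coeff_C_mul', PowerSeries.coeff_mk] at this

/-! ### Limits of power series in `x = α⁻¹` -/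

theorem CoeffLim.of_eventually {a : ℂ → ℂ⟦X⟧} {b : ℂ⟦X⟧} (g : ℕ → ℂ → ℂ)
    (e : ∀ᶠ s in Bornology.cobounded ℂ, ∀ n, cf n (a s) = g n s)
    (h : ∀ n, Tendsto (g n) (Bornology.cobounded ℂ) (𝓝 (cf n b))) : CoeffLim a b := fun n =>
  (h n).congr' (e.mono fun _ hs => (hs n).symm)

/-- Solutions of linear equations `y' = y a + b` depend continuously on `a` and `b`. -/
theorem coeffLim_of_derivative_eq {y a b : ℂ → ℂ⟦X⟧} {y' a' b' : ℂ⟦X⟧}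
    (hy : ∀ s, 𝐃 (y s) = y s * a s + b s) (hy' : 𝐃 y' = y' * a' + b')
    (h0 : ∀ s, cf 0 (y s) = cf 0 y') (ha : CoeffLim a a') (hb : CoeffLim b b') :
    CoeffLim y y' := by
  intro n
  induction n using Nat.strong_induction_on with
  | _ n ih =>
    cases n with
    | zero => simp only [h0]; exact tendsto_const_nhds
    | succ n =>
      have hn : (n : ℂ) + 1 ≠ 0 := by exact_mod_cast n.succ_ne_zero
      have e : ∀ z c d : ℂ⟦X⟧, 𝐃 z = z * c + d →
          cf (n + 1) z = (∑ p ∈ Finset.HasAntidiagonal.antidiagonal n, cf p.1 z * cf p.2 c + cf n d) *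
            ((n : ℂ) + 1)⁻¹ := by
        intro z c d h
        rw [← PowerSeries.coeff_mul, ← map_add, ← h, PowerSeries.coeff_derivative,
          mul_inv_cancel_right₀ hn]
      simp only [e _ _ _ (hy _), e _ _ _ hy']
      refine ((tendsto_finsetSum _ fun p hp => ?_).add (hb n)).mul_const _
      rw [Finset.HasAntidiagonal.mem_antidiagonal] at hp
      exact (ih _ (by omega)).mul (ha _)

/-- Coefficientwise differentiability of a family of series. -/
def HasCoeffDeriv (u : ℂ → ℂ⟦X⟧) (u' : ℂ⟦X⟧) (s : ℂ) : Prop :=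
  ∀ k, HasDerivAt (fun z => cf k (u z)) (cf k u') s

theorem HasCoeffDeriv.mul {u v : ℂ → ℂ⟦X⟧} {u' v' : ℂ⟦X⟧} {s : ℂ} (hu : HasCoeffDeriv u u' s)
    (hv : HasCoeffDeriv v v' s) :
    HasCoeffDeriv (fun z => u z * v z) (u' * v s + u s * v') s := by
  intro k
  simp only [map_add, PowerSeries.coeff_mul, ← Finset.sum_add_distrib]
  exact HasDerivAt.fun_sum fun p _ => (hu p.1).mul (hv p.2)

theorem HasCoeffDeriv.derivative {u : ℂ → ℂ⟦X⟧} {u' : ℂ⟦X⟧} {s : ℂ} (hu : HasCoeffDeriv u u' s) :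
    HasCoeffDeriv (fun z => 𝐃 (u z)) (𝐃 u') s := by
  intro k
  simp only [PowerSeries.coeff_derivative]
  exact (hu (k + 1)).mul_const _

theorem HasCoeffDeriv.unique {u : ℂ → ℂ⟦X⟧} {u' v' : ℂ⟦X⟧} {s : ℂ} (h : HasCoeffDeriv u u' s)
    (h' : HasCoeffDeriv u v' s) : u' = v' := by
  ext k
  exact (h k).unique (h' k)

/-- The logarithmic derivative in the parameter. -/
theorem HasCoeffDeriv.eq_mul_logOf {u : ℂ → ℂ⟦X⟧} {u' l' : ℂ⟦X⟧} {s : ℂ}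
    (hc : ∀ z, cc (u z) = 1) (hu : HasCoeffDeriv u u' s)
    (hl : HasCoeffDeriv (fun z => (u z).logOf) l' s) : u' = u s * l' := by
  -- Differentiate u_x = u (ln u)_x in the parameter. Then u' and u l' solve the same linear
  -- equation in x with the same initial value 0.
  have h1 : 𝐃 u' = u' * 𝐃 (u s).logOf + u s * 𝐃 l' := by
    refine hu.derivative.unique ?_
    have h := hu.mul hl.derivative
    simpa only [mul_derivative_logOf (hc _)] using h
  have hu0 : cc u' = 0 := by
    have h := hu 0
    simp only [PowerSeries.coeff_zero_eq_constantCoeff_apply, hc] at h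
    exact h.unique (hasDerivAt_const s 1)
  have hl0 : cc l' = 0 := by
    have h := hl 0
    simp only [PowerSeries.coeff_zero_eq_constantCoeff_apply,
      PowerSeries.constantCoeff_logOf (hc _)] at h
    exact h.unique (hasDerivAt_const s 0)
  refine sub_eq_zero.1 (eq_zero_of_derivative_eq (a := 𝐃 (u s).logOf) ?_ (by simp [hu0, hl0]))
  rw [map_sub, derivative_mul, h1, derivative_logOf (hc s)]
  ring

theorem coeff_logOf_scaledP (hf : IsNormalized f) (s : ℂ) (n : ℕ) :
    cf n (scaledP f s).logOf = s⁻¹ ^ n * cf n (pSeries f s).logOf := by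
  rw [scaledP, logOf_rescale (constantCoeff_pSeries hf s), PowerSeries.coeff_rescale]

/-- The series `∂u_s / ∂s`. -/
def pSeriesDot (f : ℂ⟦X⟧) (s : ℂ) : ℂ⟦X⟧ :=
  PowerSeries.mk fun k => deriv (fun z => cf k (pSeries f z)) s

/-- For s ≠ 0 the coefficient of ln u_s in degree n is exactly s^n (s A_n + q_n(1/s)), so no
exchange of limit and derivative is needed. Its s-derivative is s^n ((n + 1) A_n + O(1/s)), and (n +
1) A_n is a coefficient of (x A)' = -ln f'(ω). -/
theorem exists_coeffLim_pSeriesDot : ∃ z : ℂ → ℂ⟦X⟧,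
    (∀ s ≠ 0, PowerSeries.rescale s⁻¹ (pSeriesDot f s) = z s * scaledP f s) ∧
      CoeffLim z (-(derivOmega f hf).logOf) := by
  obtain ⟨q, hq, -⟩ := exists_logOf_scaledP hf
  set A := action f hf
  have hlog : ∀ s ≠ 0, ∀ n, cf n (pSeries f s).logOf =
      s ^ n * (s * cf n A + (q n).eval s⁻¹) := by
    intro s hs n
    rw [← hq s hs n, coeff_logOf_scaledP hf, ← mul_assoc, ← mul_pow, mul_inv_cancel₀ hs, one_pow,
      one_mul]
  set g : ℂ → ℕ → ℂ := fun s n => (n + 1) * cf n A + n * (s⁻¹ * (q n).eval s⁻¹) -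
    s⁻¹ ^ 2 * (Polynomial.derivative (q n)).eval s⁻¹
  have hl : ∀ s ≠ 0, HasCoeffDeriv (fun z => (pSeries f z).logOf)
      (PowerSeries.mk fun n => s ^ n * g s n) s := by
    intro s hs n
    have e : (fun z => cf n (pSeries f z).logOf) =ᶠ[𝓝 s]
        fun z => z ^ n * (z * cf n A + (q n).eval z⁻¹) :=
      (eventually_ne_nhds hs).mono fun z hz => hlog z hz n
    refine HasDerivAt.congr_of_eventuallyEq ?_ e
    have h1 : HasDerivAt (fun z : ℂ => (q n).eval z⁻¹)
        ((Polynomial.derivative (q n)).eval s⁻¹ * -(s ^ 2)⁻¹) s :=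
      HasDerivAt.comp s ((q n).hasDerivAt s⁻¹) (hasDerivAt_inv hs)
    have h2 := (hasDerivAt_pow n s).mul (((hasDerivAt_id s).mul_const (cf n A)).add h1)
    refine h2.congr_deriv ?_
    rw [PowerSeries.coeff_mk]
    cases n with
    | zero => simp [g]; ring
    | succ n =>
      simp only [g, Nat.add_sub_cancel, id, Pi.add_apply]
      push_cast
      have h : s * s⁻¹ = 1 := mul_inv_cancel₀ hs
      rw [← inv_pow]
      generalize (q (n + 1)).eval s⁻¹ = b
      linear_combination (-s ^ n * (n + 1) * b) * h
  refine ⟨fun s => PowerSeries.rescale s⁻¹ (PowerSeries.mk fun n => s ^ n * g s n),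
    fun s hs => ?_, ?_⟩
  · have hu : HasCoeffDeriv (pSeries f) (pSeriesDot f s) s := fun k => by
      rw [pSeriesDot, PowerSeries.coeff_mk]
      exact (differentiable_coeff_pSeries hf k s).hasDerivAt
    rw [hu.eq_mul_logOf (constantCoeff_pSeries hf) (hl s hs), map_mul, scaledP, mul_comm]
  · refine CoeffLim.of_eventually (fun n s => g s n) (eventually_ne_zero.mono fun s hs n => ?_)
      fun n => ?_
    · rw [PowerSeries.coeff_rescale, PowerSeries.coeff_mk, ← mul_assoc, ← mul_pow,
        inv_mul_cancel₀ hs, one_pow, one_mul]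
    · have hA : cf n (-(derivOmega f hf).logOf) = (fun ε : ℂ => ((n : ℂ) + 1) * cf n A +
          n * (ε * (q n).eval ε) - ε ^ 2 * (Polynomial.derivative (q n)).eval ε) 0 := by
        rw [← derivative_X_mul_action, PowerSeries.coeff_derivative, PowerSeries.coeff_succ_X_mul]
        simp only [A]
        ring
      have hc : Continuous fun ε : ℂ => ((n : ℂ) + 1) * cf n A +
          n * (ε * (q n).eval ε) - ε ^ 2 * (Polynomial.derivative (q n)).eval ε := by
        have h1 := (q n).continuous
        have h2 := (Polynomial.derivative (q n)).continuous
        fun_prop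
      rw [hA]
      exact (hc.tendsto 0).comp tendsto_inv_cobounded

/-- The second order Taylor expansion of `(1 + y) ^ n`. -/
theorem exists_one_add_pow (n : ℕ) : ∃ r : ℂ[X],
    (∀ y : ℂ, (1 + y) ^ n = 1 + n * y + y ^ 2 * r.eval y) ∧ r.eval 0 = n * (n - 1) / 2 := by
  induction n with
  | zero => exact ⟨0, by simp, by simp⟩
  | succ n ih =>
    obtain ⟨r, h1, h2⟩ := ih
    refine ⟨(1 + Polynomial.X) * r + Polynomial.C (n : ℂ), fun y => ?_, ?_⟩
    · rw [pow_succ, h1]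
      simp only [Polynomial.eval_add, Polynomial.eval_mul, Polynomial.eval_one, Polynomial.eval_X,
        Polynomial.eval_C]
      push_cast
      ring
    · simp only [Polynomial.eval_add, Polynomial.eval_mul, Polynomial.eval_one, Polynomial.eval_X,
        Polynomial.eval_C, h2]
      push_cast
      ring

/-- The logarithm of `p_{s + H}(s α) / (p_s(s α) (s α) ^ H)`. -/
def logRatio (f : ℂ⟦X⟧) (H s : ℂ) : ℂ⟦X⟧ :=
  (PowerSeries.rescale s⁻¹ (pSeries f (s + H))).logOf - (scaledP f s).logOf

/-- The series `p_{s + H}(s α) / (p_s(s α) (s α) ^ H)`. -/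
def ratio (f : ℂ⟦X⟧) (H s : ℂ) : ℂ⟦X⟧ :=
  PowerSeries.rescale s⁻¹ (pSeries f (s + H)) * (scaledP f s)⁻¹

theorem eventually_add_ne_zero (H : ℂ) : ∀ᶠ s : ℂ in Bornology.cobounded ℂ, s + H ≠ 0 :=
  (Bornology.eventually_ne_cobounded (-H)).mono fun _ hs h => hs (eq_neg_of_add_eq_zero_left h)

/-- In degree n, A contributes s A_n ((1 + H/s)^(n+1) - 1). Its orders 1 and 1/s give -H ln f'(ω)
and ½ H² (1 - ω'), since n (n + 1) A_n is the coefficient of 1 - ω'. The remainder contributes n H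
q_n(0)/s, which is the term ½ H x (ln ω')'. -/
theorem coeffLim_logRatio_second (H : ℂ) :
    CoeffLim (fun s => 𝐂 s * (logRatio f H s - 𝐂 (-H) * (derivOmega f hf).logOf))
      (𝐂 (H / 2) * (𝐂 H * (1 - 𝐃 (omega f hf)) + 𝐗 * 𝐃 (𝐃 (omega f hf)).logOf)) := by
  obtain ⟨q, hq, hq0⟩ := exists_logOf_scaledP hf
  set A := action f hf
  have hl : ∀ n, cf n (derivOmega f hf).logOf = -((n + 1) * cf n A) := by
    intro n
    have h := congrArg (cf n) (derivative_X_mul_action hf)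
    rw [PowerSeries.coeff_derivative, PowerSeries.coeff_succ_X_mul, map_neg] at h
    linear_combination h
  have hw : ∀ n, cf n (1 - 𝐃 (omega f hf)) = n * (n + 1) * cf n A := by
    intro n
    have h := congrArg (cf n) (X_mul_derivative_logOf_derivOmega hf)
    rw [coeff_X_mul_derivative, hl, map_sub] at h
    rw [map_sub]
    linear_combination h
  choose r hr hr0 using exists_one_add_pow
  -- Here ε = 1/s and η = 1/(s + H). Factoring q_n(x) - q_n(0) = x `divX`(x) and using s η = 1 - H η
  -- removes every positive power of s, so the limit is the value at (0, 0).
  set g : ℕ → ℂ → ℂ → ℂ := fun n ε η =>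
    cf n A * H ^ 2 * (r (n + 1)).eval (H * ε) +
      (n * H + H ^ 2 * ε * (r n).eval (H * ε)) * (q n).eval η +
      ((1 - H * η) * (q n).divX.eval η - (q n).divX.eval ε)
  refine CoeffLim.of_eventually (fun n s => g n s⁻¹ (s + H)⁻¹) ?_ fun n => ?_
  · filter_upwards [eventually_ne_zero, eventually_add_ne_zero H] with s hs hsH n
    have h1 : cf n (PowerSeries.rescale s⁻¹ (pSeries f (s + H))).logOf =
        (1 + H * s⁻¹) ^ n * ((s + H) * cf n A + (q n).eval (s + H)⁻¹) := by
      rw [← hq _ hsH n, coeff_logOf_scaledP hf, logOf_rescale (constantCoeff_pSeries hf _),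
        PowerSeries.coeff_rescale, ← mul_assoc, ← mul_pow]
      congr 2
      field_simp
    have h2 : ∀ x : ℂ, (q n).eval x = (q n).eval 0 + x * (q n).divX.eval x := by
      intro x
      conv_lhs => rw [← Polynomial.divX_mul_X_add (q n)]
      rw [Polynomial.eval_add, Polynomial.eval_mul, Polynomial.eval_X, Polynomial.eval_C,
        Polynomial.coeff_zero_eq_eval_zero]
      ring
    have h3 : s * s⁻¹ = 1 := mul_inv_cancel₀ hs
    have h4 : (s + H) * (s + H)⁻¹ = 1 := mul_inv_cancel₀ hsH
    have h5 := hr n (H * s⁻¹)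
    have h6 := hr (n + 1) (H * s⁻¹)
    rw [coeff_C_mul', map_sub, coeff_C_mul', logRatio, map_sub, h1, hq s hs, hl]
    have h7 : (1 + H * s⁻¹) ^ n * (s + H) = s * (1 + H * s⁻¹) ^ (n + 1) := by
      rw [pow_succ]; linear_combination -(H * (1 + H * s⁻¹) ^ n) * h3
    have h8 := h2 s⁻¹
    have h9 := h2 (s + H)⁻¹
    simp only [g]
    push_cast at h6
    generalize (q n).divX.eval s⁻¹ = d at *
    generalize (q n).divX.eval (s + H)⁻¹ = d' at *
    generalize (q n).eval s⁻¹ = e at *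
    generalize (q n).eval (s + H)⁻¹ = e' at *
    generalize (r n).eval (H * s⁻¹) = ρ at *
    generalize (r (n + 1)).eval (H * s⁻¹) = ρ' at *
    generalize (1 + H * s⁻¹) ^ n = P at *
    generalize (1 + H * s⁻¹) ^ (n + 1) = P' at *
    linear_combination cf n A * s * h7 + cf n A * s ^ 2 * h6 +
      cf n A * ((n + 1) * H * s + H ^ 2 * ρ' * (s * s⁻¹ + 1)) * h3 + e' * s * h5 +
      e' * (n * H + H ^ 2 * s⁻¹ * ρ) * h3 + s * h9 - s * h8 + d' * h4 - d * h3
  · have h : cf n (𝐂 (H / 2) * (𝐂 H * (1 - 𝐃 (omega f hf)) + 𝐗 * 𝐃 (𝐃 (omega f hf)).logOf)) =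
        g n 0 0 := by
      rw [coeff_C_mul', map_add, coeff_C_mul', hw, coeff_X_mul_derivative]
      have := hq0 n
      have h0 := hr0 (n + 1)
      push_cast at h0
      simp only [g, mul_zero, h0, this]
      ring
    have hc : Continuous fun x : ℂ × ℂ => g n x.1 x.2 := by
      have h1 := (q n).continuous
      have h2 := (q n).divX.continuous
      have h3 := (r n).continuous
      have h4 := (r (n + 1)).continuous
      fun_prop
    have ht : Tendsto (fun s : ℂ => (s⁻¹, (s + H)⁻¹)) (Bornology.cobounded ℂ) (𝓝 (0, 0)) :=
      tendsto_inv_cobounded.prodMk_nhds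
        (tendsto_inv_cobounded.comp (tendsto_add_const_cobounded H))
    rw [h]
    clear_value g
    exact (hc.tendsto (0, 0)).comp ht

theorem CoeffLim.of_C_mul_sub {a : ℂ → ℂ⟦X⟧} {b c : ℂ⟦X⟧}
    (h : CoeffLim (fun s => 𝐂 s * (a s - b)) c) : CoeffLim a b := by
  have h1 := (CoeffLim.const b).add (coeffLim_C_inv.mul h)
  rw [zero_mul, add_zero] at h1
  refine h1.congr' fun s hs => ?_
  have h2 : 𝐂 s⁻¹ * 𝐂 s = 1 := by rw [← map_mul, inv_mul_cancel₀ hs, map_one]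
  linear_combination (-(a s - b)) * h2

theorem derivative_ratio (hf : IsNormalized f) (H s : ℂ) :
    𝐃 (ratio f H s) = ratio f H s * 𝐃 (logRatio f H s) :=
  derivative_mul_inv (by rw [constantCoeff_rescale, constantCoeff_pSeries hf])
    (constantCoeff_scaledP hf s)

theorem constantCoeff_ratio (hf : IsNormalized f) (H s : ℂ) : cc (ratio f H s) = 1 :=
  constantCoeff_mul_inv (by rw [constantCoeff_rescale, constantCoeff_pSeries hf])
    (constantCoeff_scaledP hf s)

theorem coeffLim_ratio (H : ℂ) :
    CoeffLim (ratio f H) (onePow (derivOmega f hf) (-H)) := by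
  refine coeffLim_of_derivative_eq (b := fun _ => 0) (b' := 0)
    (fun s => by rw [add_zero]; exact derivative_ratio hf H s) ?_ (fun s => ?_)
    (CoeffLim.of_C_mul_sub (coeffLim_logRatio_second hf H)).derivative (CoeffLim.const 0)
  · rw [derivative_onePow (constantCoeff_derivOmega hf), derivative_mul, PowerSeries.derivative_C]
    ring
  · simp [constantCoeff_ratio hf, constantCoeff_onePow (constantCoeff_derivOmega hf)]

/-- With R the ratio, w its limit and l = ln f'(ω), y = s (R - w) solves y' = y (ln R)' + w (s (ln R
+ H l))'. Both coefficients of this linear equation converge by the logarithmic expansion. -/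
theorem coeffLim_ratio_second (H : ℂ) :
    CoeffLim (fun s => 𝐂 s * (ratio f H s - onePow (derivOmega f hf) (-H)))
      (onePow (derivOmega f hf) (-H) *
        (𝐂 (H / 2) * (𝐂 H * (1 - 𝐃 (omega f hf)) + 𝐗 * 𝐃 (𝐃 (omega f hf)).logOf))) := by
  have h1 := coeffLim_logRatio_second hf H
  have h2 := derivative_onePow (constantCoeff_derivOmega hf) (-H)
  set w := onePow (derivOmega f hf) (-H)
  set l := (derivOmega f hf).logOf
  have h3 : 𝐃 (𝐂 (-H) * l) = 𝐂 (-H) * 𝐃 l := by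
    rw [derivative_mul, PowerSeries.derivative_C, zero_mul, zero_add]
  refine coeffLim_of_derivative_eq (fun s => ?_) ?_ (fun s => ?_)
    (CoeffLim.of_C_mul_sub h1).derivative ((CoeffLim.const w).mul h1.derivative)
  · simp only [derivative_mul, map_sub, PowerSeries.derivative_C, derivative_ratio hf, h2]
    ring
  · rw [derivative_mul w, h3, h2]
    ring
  · have hw : cc w = 1 := constantCoeff_onePow (constantCoeff_derivOmega hf) _
    have := constantCoeff_derivative_omega hf
    simp [constantCoeff_ratio hf, hw, this]

/-! ### Limits of ln p_s and of its derivative in α -/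

theorem coeffLim_logOf_scaledP :
    CoeffLim (fun s => (scaledP f s).logOf - 𝐂 s * action f hf)
      (𝐂 (1 / 2) * (𝐃 (omega f hf)).logOf) := by
  obtain ⟨q, hq, hq0⟩ := exists_logOf_scaledP hf
  refine CoeffLim.of_eventually (fun n s => (q n).eval s⁻¹)
    (eventually_ne_zero.mono fun s hs n => ?_) fun n => ?_
  · rw [map_sub, coeff_C_mul', hq s hs]; ring
  · rw [coeff_C_mul', ← hq0]
    exact ((q n).continuous.tendsto 0).comp tendsto_inv_cobounded

/-- Since α ∂/∂α = -x d/dx, the series on the left is p_s'/p_s at sα. Only s A survives division by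
s, leaving x (1 - x A') = ω. -/
theorem coeffLim_logDerivative :
    CoeffLim (fun s => 𝐗 * (1 - 𝐂 s⁻¹ * (𝐗 * 𝐃 (scaledP f s).logOf))) (omega f hf) := by
  have h := (CoeffLim.const 𝐗).mul ((CoeffLim.const (1 - 𝐗 * 𝐃 (action f hf))).sub
    (coeffLim_C_inv.mul ((CoeffLim.const 𝐗).mul (coeffLim_logOf_scaledP hf).derivative)))
  rw [zero_mul, sub_zero, X_mul_derivative_action, X_mul_one_sub_eulerSaddle] at h
  refine h.congr' fun s hs => ?_
  have h2 : 𝐂 s⁻¹ * 𝐂 s = 1 := by rw [← map_mul, inv_mul_cancel₀ hs, map_one]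
  rw [map_sub, derivative_mul, PowerSeries.derivative_C, ← X_mul_derivative_action]
  linear_combination (-𝐗 * 𝐗 * 𝐃 (action f hf)) * h2

/-! ### Series in `α` -/

theorem ofSeries_mul (u v : ℂ⟦X⟧) : ofSeries (u * v) = ofSeries u * ofSeries v := by
  simp [ofSeries]

theorem ofSeries_add (u v : ℂ⟦X⟧) : ofSeries (u + v) = ofSeries u + ofSeries v := by
  simp [ofSeries]

theorem ofSeries_neg (u : ℂ⟦X⟧) : ofSeries (-u) = -ofSeries u := by
  simp [ofSeries]

theorem ofSeries_sub (u v : ℂ⟦X⟧) : ofSeries (u - v) = ofSeries u - ofSeries v := by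
  simp [ofSeries]

theorem ofSeries_one : ofSeries 1 = 1 := by
  simp [ofSeries]

theorem ofSeries_C (z : ℂ) : ofSeries (𝐂 z) = const z := by
  simp [ofSeries, const]

theorem ofSeries_X : ofSeries 𝐗 = alphaPow (-1) := by
  simp [ofSeries, alphaPow]

theorem const_mul (a b : ℂ) : const (a * b) = const a * const b := by simp [const]

theorem const_one : const 1 = 1 := by simp [const]

theorem alphaPow_add (a b : ℂ) : alphaPow (a + b) = alphaPow a * alphaPow b := by
  simp [alphaPow, add_comm]

theorem alphaPow_zero : alphaPow 0 = 1 := by simp [alphaPow]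

theorem coeff_alphaPow_mul (c : ℂ) (F : AsympSeries) (γ : ℂ) :
    (alphaPow c * F).coeff γ = F.coeff (γ + c) := by
  simp [alphaPow, HahnSeries.coeff_single_mul]

theorem coeff_ofSeries_natCast (u : ℂ⟦X⟧) (n : ℕ) :
    (ofSeries u).coeff (n : ℂ) = Polynomial.C (cf n u) := by
  rw [ofSeries, HahnSeries.ofPowerSeries_apply_coeff, PowerSeries.coeff_map]

theorem coeff_ofSeries_of_forall_ne (u : ℂ⟦X⟧) {γ : ℂ} (h : ∀ n : ℕ, (n : ℂ) ≠ γ) :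
    (ofSeries u).coeff γ = 0 := by
  rw [ofSeries, HahnSeries.ofPowerSeries_apply]
  refine HahnSeries.embDomain_notin_image_support ?_
  rintro ⟨n, -, hn⟩
  exact h n hn

theorem CoeffLim.coeffTendsto {a : ℂ → ℂ⟦X⟧} {b : ℂ⟦X⟧} (h : CoeffLim a b) (c : ℂ) :
    CoeffTendsto (fun s => alphaPow c * ofSeries (a s)) (Bornology.cobounded ℂ)
      (alphaPow c * ofSeries b) := by
  intro γ j
  simp only [coeff_alphaPow_mul]
  by_cases hn : ∃ n : ℕ, (n : ℂ) = γ + c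
  · obtain ⟨n, hn⟩ := hn
    simp only [← hn, coeff_ofSeries_natCast, Polynomial.coeff_C]
    split_ifs
    · exact h n
    · exact tendsto_const_nhds
  · simp only [coeff_ofSeries_of_forall_ne _ (not_exists.1 hn)]
    exact tendsto_const_nhds

theorem CoeffTendsto.congr' {F G : ℂ → AsympSeries} {K : AsympSeries}
    (h : CoeffTendsto F (Bornology.cobounded ℂ) K) (e : ∀ s ≠ 0, G s = F s) :
    CoeffTendsto G (Bornology.cobounded ℂ) K := fun γ j =>
  (h γ j).congr' (eventually_ne_zero.mono fun s hs => by simp only [e s hs])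

theorem CoeffTendsto.const_add {F : ℂ → AsympSeries} {l : Filter ℂ} {K : AsympSeries}
    (h : CoeffTendsto F l K) (G : AsympSeries) : CoeffTendsto (fun s => G + F s) l (G + K) :=
  fun γ j => by simpa using (h γ j).const_add ((G.coeff γ).coeff j)

theorem scale_add (s : ℂ) (F G : AsympSeries) : scale s (F + G) = scale s F + scale s G := by
  ext1
  funext γ
  simp [scale, mul_add]

theorem coeff_lnAlpha_mul (F : AsympSeries) (γ : ℂ) :
    (lnAlpha * F).coeff γ = Polynomial.X * F.coeff γ := by
  simp [lnAlpha, HahnSeries.C_apply]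

theorem coeff_const_mul (z : ℂ) (F : AsympSeries) (γ : ℂ) :
    (const z * F).coeff γ = Polynomial.C z * F.coeff γ := by
  simp [const, HahnSeries.C_apply]

theorem scale_lnAlpha_mul (s : ℂ) (F : AsympSeries) :
    scale s (lnAlpha * F) = (lnAlpha + const (Complex.log s)) * scale s F := by
  ext1
  funext γ
  rw [add_mul, HahnSeries.coeff_add, coeff_lnAlpha_mul, coeff_const_mul]
  simp only [scale, coeff_lnAlpha_mul, Polynomial.mul_comp, Polynomial.X_comp]
  ring

theorem scale_const_mul (s z : ℂ) (F : AsympSeries) :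
    scale s (const z * F) = const z * scale s F := by
  ext1
  funext γ
  rw [coeff_const_mul]
  simp only [scale, coeff_const_mul, Polynomial.mul_comp, Polynomial.C_comp]
  ring

theorem scale_ofSeries {s : ℂ} (hs : s ≠ 0) (u : ℂ⟦X⟧) :
    scale s (ofSeries u) = ofSeries (PowerSeries.rescale s⁻¹ u) := by
  have h := scale_alphaPow_mul_ofSeries hs 0 u
  rwa [alphaPow_zero, Complex.cpow_zero, const_one, one_mul, one_mul, one_mul] at h

theorem alphaDeriv_alphaPow_mul_ofSeries (c : ℂ) (u : ℂ⟦X⟧) :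
    alphaDeriv (alphaPow c * ofSeries u) =
      alphaPow (c - 1) * ofSeries (𝐂 c * u - 𝐗 * 𝐃 u) := by
  rw [sub_eq_neg_add, alphaPow_add, mul_assoc, alphaDeriv]
  congr 1
  ext1
  funext γ
  simp only [coeff_alphaPow_mul]
  by_cases hn : ∃ n : ℕ, (n : ℂ) = γ + c
  · obtain ⟨n, hn⟩ := hn
    rw [← hn, coeff_ofSeries_natCast, coeff_ofSeries_natCast, map_sub, coeff_C_mul',
      coeff_X_mul_derivative, Polynomial.derivative_C, add_zero, ← Polynomial.C_mul]
    congr 1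
    linear_combination cf n u * hn
  · simp [coeff_ofSeries_of_forall_ne _ (not_exists.1 hn)]

theorem scale_p (f : ℂ⟦X⟧) {s : ℂ} (hs : s ≠ 0) (t : ℂ) :
    scale s (p f t) =
      const (s ^ t) * (alphaPow t * ofSeries (PowerSeries.rescale s⁻¹ (pSeries f t))) := by
  rw [p, scale_alphaPow_mul_ofSeries hs]

/-- For s ≠ 0 the divisor is a unit, so `Ring.inverse` is a true inverse and not its default value
0. -/
theorem mul_inverse_scale_p (hf : IsNormalized f) {s : ℂ} (hs : s ≠ 0) {F G : AsympSeries}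
    (h : F = G * scale s (p f s)) : F * Ring.inverse (scale s (p f s)) = G := by
  rw [h, Ring.mul_inverse_cancel_right _ _ (isUnit_scale_p hf s hs)]

theorem mul_inverse_ratio (hf : IsNormalized f) (H : ℂ) {s : ℂ} (hs : s ≠ 0) :
    scale s (p f (s + H)) * Ring.inverse (scale s (p f s)) =
      const (s ^ H) * (alphaPow H * ofSeries (ratio f H s)) := by
  refine mul_inverse_scale_p hf hs ?_
  have h : ratio f H s * scaledP f s = PowerSeries.rescale s⁻¹ (pSeries f (s + H)) := by
    rw [ratio, mul_assoc, PowerSeries.inv_mul_cancel _ (by simp [constantCoeff_scaledP hf]),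
      mul_one]
  rw [scale_p f hs, scale_p f hs, ← h, ofSeries_mul, alphaPow_add, Complex.cpow_add _ _ hs,
    const_mul, scaledP]
  ring

theorem const_cpow_mul_const_cpow_neg {s : ℂ} (hs : s ≠ 0) (H : ℂ) :
    const (s ^ H) * const (s ^ (-H)) = 1 := by
  rw [← const_mul, ← Complex.cpow_add _ _ hs, add_neg_cancel, Complex.cpow_zero, const_one]

/-! ### The five limits as series in α -/

theorem coeffTendsto_pDot :
    CoeffTendsto
      (fun s => scale s (pDot f s) * Ring.inverse (scale s (p f s)) - const (Complex.log s))
      (Bornology.cobounded ℂ) (lnAlpha - ofSeries (derivOmega f hf).logOf) := by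
  obtain ⟨z, hz, hl⟩ := exists_coeffLim_pSeriesDot hf
  have h := (hl.coeffTendsto 0).const_add lnAlpha
  rw [alphaPow_zero, one_mul, ofSeries_neg, ← sub_eq_add_neg] at h
  refine h.congr' fun s hs => ?_
  have e : pDot f s = lnAlpha * (alphaPow s * ofSeries (pSeries f s)) +
      alphaPow s * ofSeries (pSeriesDot f s) := by
    rw [pDot, pSeriesDot]; ring
  rw [mul_inverse_scale_p hf hs
    (G := lnAlpha + const (Complex.log s) + ofSeries (z s))]
  · ring
  · rw [e, scale_add, scale_lnAlpha_mul, ← p, scale_p f hs, scale_alphaPow_mul_ofSeries hs,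
      hz s hs, ofSeries_mul, scaledP]
    ring

theorem coeffTendsto_ratio (H : ℂ) :
    CoeffTendsto
      (fun s => scale s (p f (s + H)) * Ring.inverse (scale s (p f s)) * const (s ^ (-H)))
      (Bornology.cobounded ℂ) (alphaPow H * ofSeries (onePow (derivOmega f hf) (-H))) := by
  refine ((coeffLim_ratio hf H).coeffTendsto H).congr' fun s hs => ?_
  rw [mul_inverse_ratio hf H hs]
  linear_combination (alphaPow H * ofSeries (ratio f H s)) * const_cpow_mul_const_cpow_neg hs H

theorem coeffTendsto_lnP :
    CoeffTendsto
      (fun s => scale s (lnP f s) - const s * scale s lnAlpha +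
        const s * alphaPow 1 * ofSeries (integral (derivOmega f hf).logOf))
      (Bornology.cobounded ℂ)
      (const (1 / 2) * ofSeries (𝐃 (omega f hf)).logOf) := by
  have h := (coeffLim_logOf_scaledP hf).coeffTendsto 0
  rw [alphaPow_zero, one_mul, ofSeries_mul, ofSeries_C] at h
  refine h.congr' fun s hs => ?_
  have h1 : alphaPow 1 * alphaPow (-1) = 1 := by
    rw [← alphaPow_add, add_neg_cancel, alphaPow_zero]
  rw [lnP, scale_add, scale_const_mul, scale_ofSeries hs, integral_logOf_derivOmega,
    ← logOf_rescale (constantCoeff_pSeries hf s), ← scaledP, ofSeries_neg, ofSeries_mul,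
    ofSeries_X, ofSeries_sub, ofSeries_mul, ofSeries_C]
  linear_combination (-const s * ofSeries (action f hf)) * h1

theorem coeffTendsto_ratio_second (H : ℂ) :
    CoeffTendsto
      (fun s =>
        scale s (p f (s + H)) * Ring.inverse (scale s (p f s)) * const (s ^ (1 - H)) -
          const s * alphaPow H * ofSeries (onePow (derivOmega f hf) (-H)))
      (Bornology.cobounded ℂ)
      (const (H / 2) * alphaPow H * ofSeries (onePow (derivOmega f hf) (-H)) *
        (const H * (1 - ofSeries (𝐃 (omega f hf))) +
          alphaPow (-1) * ofSeries (𝐃 (𝐃 (omega f hf)) * (𝐃 (omega f hf))⁻¹))) := by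
  have hw := constantCoeff_derivative_omega hf
  have hl : 𝐃 (𝐃 (omega f hf)).logOf = 𝐃 (𝐃 (omega f hf)) * (𝐃 (omega f hf))⁻¹ := by
    have h1 : 𝐃 (omega f hf) * (𝐃 (omega f hf))⁻¹ = 1 :=
      PowerSeries.mul_inv_cancel _ (by simp [hw])
    conv_rhs => rw [derivative_logOf hw]
    linear_combination (-𝐃 (𝐃 (omega f hf)).logOf) * h1
  have h := (coeffLim_ratio_second hf H).coeffTendsto H
  rw [hl, ofSeries_mul, ofSeries_mul, ofSeries_add, ofSeries_mul, ofSeries_mul, ofSeries_sub,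
    ofSeries_one, ofSeries_C, ofSeries_C, ofSeries_X] at h
  convert h.congr' (G := _) fun s hs => ?_ using 1
  · ring
  · rw [mul_inverse_ratio hf H hs, sub_eq_add_neg 1 H, Complex.cpow_add _ _ hs, Complex.cpow_one,
      const_mul, ofSeries_mul, ofSeries_sub, ofSeries_C]
    linear_combination (const s * alphaPow H * ofSeries (ratio f H s)) *
      const_cpow_mul_const_cpow_neg hs H

theorem coeffTendsto_alphaDeriv :
    CoeffTendsto
      (fun s => scale s (alphaDeriv (p f s)) * Ring.inverse (scale s (p f s)))
      (Bornology.cobounded ℂ) (ofSeries (omega f hf)) := by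
  have h := (coeffLim_logDerivative hf).coeffTendsto 0
  rw [alphaPow_zero, one_mul] at h
  refine h.congr' fun s hs => mul_inverse_scale_p hf hs ?_
  have h1 : PowerSeries.rescale s⁻¹ (𝐂 s * pSeries f s - 𝐗 * 𝐃 (pSeries f s)) =
      𝐂 s * (1 - 𝐂 s⁻¹ * (𝐗 * 𝐃 (scaledP f s).logOf)) * scaledP f s := by
    have h2 : 𝐂 s⁻¹ * 𝐂 s = 1 := by rw [← map_mul, inv_mul_cancel₀ hs, map_one]
    have h3 := mul_derivative_logOf (constantCoeff_scaledP hf s)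
    have h4 : PowerSeries.rescale s⁻¹ (𝐗 * 𝐃 (pSeries f s)) = 𝐗 * 𝐃 (scaledP f s) := by
      ext n
      simp only [PowerSeries.coeff_rescale, coeff_X_mul_derivative, scaledP]
      ring
    have h5 : PowerSeries.rescale s⁻¹ (𝐂 s * pSeries f s) = 𝐂 s * scaledP f s := by
      ext n
      simp only [PowerSeries.coeff_rescale, coeff_C_mul', scaledP]
      ring
    rw [map_sub, h4, h5]
    linear_combination 𝐗 * h3 + (𝐗 * 𝐃 (scaledP f s).logOf * scaledP f s) * h2
  -- The derivative scales by s^(s-1), and the missing factor s is the `𝐂 s` split off in `h1`.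
  have h6 : s ^ (s - 1) * s = s ^ s := by
    rw [Complex.cpow_sub _ _ hs, Complex.cpow_one, div_mul_cancel₀ _ hs]
  rw [scale_p f hs, ← scaledP, p, alphaDeriv_alphaPow_mul_ofSeries,
    scale_alphaPow_mul_ofSeries hs, h1, ← h6, const_mul, sub_eq_add_neg s 1, alphaPow_add]
  simp only [ofSeries_mul, ofSeries_C, ofSeries_X]
  ring

end BinomialType

end

open BinomialType in
theorem mainTheorem6 (f : PowerSeries ℂ) (hf : IsNormalized f) (H : ℂ) :
    -- first limit formula
    CoeffTendsto
      (fun s => scale s (pDot f s) * Ring.inverse (scale s (p f s)) - const (Complex.log s))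
      (Bornology.cobounded ℂ)
      (lnAlpha - ofSeries (derivOmega f hf).logOf) ∧
    CoeffTendsto
      (fun s => scale s (p f (s + H)) * Ring.inverse (scale s (p f s)) * const (s ^ (-H)))
      (Bornology.cobounded ℂ)
      (alphaPow H * ofSeries (onePow (derivOmega f hf) (-H))) ∧
    -- second limit formula
    CoeffTendsto
      (fun s => scale s (lnP f s) - const s * scale s lnAlpha +
        const s * alphaPow 1 * ofSeries (integral (derivOmega f hf).logOf))
      (Bornology.cobounded ℂ)
      (const (1 / 2) * ofSeries (PowerSeries.derivative ℂ (omega f hf)).logOf) ∧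
    CoeffTendsto
      (fun s =>
        scale s (p f (s + H)) * Ring.inverse (scale s (p f s)) * const (s ^ (1 - H)) -
          const s * alphaPow H * ofSeries (onePow (derivOmega f hf) (-H)))
      (Bornology.cobounded ℂ)
      (const (H / 2) * alphaPow H * ofSeries (onePow (derivOmega f hf) (-H)) *
        (const H * (1 - ofSeries (PowerSeries.derivative ℂ (omega f hf))) +
          alphaPow (-1) *
            ofSeries (PowerSeries.derivative ℂ (PowerSeries.derivative ℂ (omega f hf)) *
              (PowerSeries.derivative ℂ (omega f hf))⁻¹))) ∧
    -- limit of the logarithmic derivative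
    CoeffTendsto
      (fun s => scale s (alphaDeriv (p f s)) * Ring.inverse (scale s (p f s)))
      (Bornology.cobounded ℂ)
      (ofSeries (omega f hf)) :=
  ⟨coeffTendsto_pDot hf, coeffTendsto_ratio hf H, coeffTendsto_lnP hf,
    coeffTendsto_ratio_second hf H, coeffTendsto_alphaDeriv hf⟩
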